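/- **Setting.** Let $\mathbb F$ be a finite field with $q$ elements, $r_1,r_2$ positive integers with $\gcd(q,r_1r_2)=1$, $\mathbb L$ an extension field of $\mathbb F$, and $\boldsymbol\alpha=(\alpha_1,\alpha_2)\in\mathbb L^2$ with $\alpha_i^{r_i}=1$ (for instance, primitive $r_i$-th roots of unity). Let $\mathcal I=\{0,\dots,r_1-1\}\times\{0,\dots,r_2-1\}$, let $2\le t\le 4$ with $t\le\lfloor r_i/2\rfloor$ for $i=1,2$, let $\tau\in\mathcal I$, and let $e=\sum_{m\in\mathcal I}e_m\mathbf X^m\in\mathbb F[X_1,X_2]$ have at most $t$ nonzero coefficients. Let $U=(u_n)_{n\in\mathbb N^2}$ with $u_n=e(\alpha_1^{\tau_1+n_1},\alpha_2^{\tau_2+n_2})$. Let $\preceq$ be the componentwise order on $\mathbb N^2$, and let $\le_T$ be either the lexicographic order with $X_1>X_2$ or the graded order with $X_2>X_1$ (total degree first; among indices of equal degree, the one with larger second coordinate is larger). $LP(f)$ is the leading exponent of $f\in\mathbb L[X_1,X_2]$. For $f=\sum f_m\mathbf X^m\in\mathbb L[X_1,X_2]$ with $LP(f)=s$ put $f[U]_n=\sum_m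 f_m u_{m+n-s}$ if $s\preceq n$ and $f[U]_n=0$ otherwise. Put $\Lambda(u^l)=\{f: f[U]_k=0$ whenever $s\preceq k<_T l\}$ and $\Lambda(U)=\{f: f[U]_k=0$ for all $k\in\mathbb N^2\}$. Let $$\mathcal B=\mathcal B(2t+1)=\{(l_1,l_2)\in\mathcal I:(l_1+1)(l_2+1)\le 2t+1\}\setminus\{(2t,0),(0,2t)\}.$$ **The algorithm.** The Berlekamp–Massey–Sakata algorithm (BMSa) on $\mathcal B$ treats the indices of $\mathcal B$ one by one in increasing $\le_T$-order. It starts with $F_{(0,0)}=\{1\}$, $G_{(0,0)}=\emptyset$. The members of $G_l$ are polynomials $g$, each with an associated index $k<_T l$ such that $g[U]_k\ne0$. The step at $l\in\mathcal B$ turns $(F,G)=(F_l,G_l)$ into the pair $(F',G')$ for the next index (or into the final pair, if $l$ is the last index) as follows. Let $\Delta=\{n: LP(f)\not\preceq n\ \forall f\in F\}$ and $\Delta'=\Delta\cup\{n: n\preceq l-LP(f)$ for some $f\in F$ with $f[U]_l\neq0\}$. * $F'$ contains, for each $\preceq$-minimal element $r$ of $\mathbb N^2\setminus\Delta'$, exactly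 one polynomial $h$, obtained from some $f\in F$ with $LP(f)=s\preceq r$: $h=\mathbf X^{r-s}f$ if $f[U]_l=0$ or $r\not\preceq l$; otherwise $h=\mathbf X^{r-s}f-\frac{f[U]_l}{g[U]_k}\mathbf X^{r-l+k-LP(g)}g$ for some $g\in G$, with associated index $k$, such that $l-r\preceq k-LP(g)$ (Berlekamp procedure). * $G'$ consists of the $g\in G$ (with their $k$) for which $k-LP(g)$ is $\preceq$-maximal in $\Delta'$, and of the $f\in F$ (with associated index $l$) for which $f[U]_l\ne0$, $l-LP(f)\notin\Delta$, and $l-LP(f)$ is maximal in $\Delta'$. The choices in a step are arbitrary; the statement is about every run of the algorithm. Write $F_l=\{f^{(1)},\dots,f^{(d)}\}$ and $s^{(i)}=LP(f^{(i)})$, numbered so that $s^{(1)}_1>\dots>s^{(d)}_1$. **Proposition.** Consider a run of the BMSa on $\mathcal B$, and suppose that one of the following two cases holds: 1. $l=(0,2t-1)$ and $s^{(2)}_2=t$; put $p=f^{(2)}$, $p'=f^{(1)}$; 2. $l=(2t-1,0)$ and $s^{(1)}_1=t$; put $p=f^{(1)}$, $p'=f^{(2)}$. Then $d=2$, and $G_l=\{g\}$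 for a single polynomial $g$, with associated index $k\in\mathcal I$, $k<_T l$, $v:=g[U]_k\neq0$ and $k-LP(g)=(s^{(1)}_1-1,\,s^{(2)}_2-1)$. For $c\in\mathbb L$ put $h_c=p-\frac cv g$. Then: * a) There is $b\in\mathbb L$ such that $h_b\in\Lambda(u^l)$ and $h_b[U]_m=0$ for all $m\in\mathcal B$ with $m\ge_T l$. The step at $l$ turns $F_l$ into $\{p',h_b\}$, and $h_b$ belongs to $F_m$ for all $m\in\mathcal B$ with $m>_T l$ and to the final set of polynomials; this final set is a Groebner basis of $\Lambda(U)$. * b) $G_m=G_l$ for all $m\in\mathcal B$ with $m\ge_T l$, and the final set $G$ is also equal to $G_l$. * Hence the updates after the step at $l$ do not depend on the choice of $b$: let $c,c'\in\mathbb L$, and suppose that the BMSa is resumed after the step at $l$ with $\{p',h_c\}$ and $G_l$, giving sets $F^*_m$, $G^*_m$ at the later stages (the $m\in\mathcal B$ with $m>_T l$, and the final stage). Then $h_c\in F^*_m$ and $G^*_m=G_l$ at each of these stages, and the sets $(F^*_m\setminus\{h_c\})\cup\{h_{c'}\}$, $G^*_m$ are those of a run of the BMSa resumed after the step at $l$ with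 $\{p',h_{c'}\}$ and $G_l$. -/

import Mathlib

open scoped MonomialOrder

noncomputable section

namespace BMS

/-- Indices `n = (n₁, n₂) ∈ ℕ × ℕ`, which are also the exponents of the monomials in two variables.
The order `≤` of `Idx` is the componentwise partial order. -/
abbrev Idx : Type := Fin 2 →₀ ℕ

/-- The index `(a, b)`. -/
def pt (a b : ℕ) : Idx := Finsupp.single 0 a + Finsupp.single 1 b

/-- The graded order with `X₂ > X₁`: total degrees are compared first, and among indices of the same
total degree the one with the larger second coordinate is the larger one, so that
`(d, 0) < (d - 1, 1) < ⋯ < (0, d) < (d + 1, 0)`. -/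
def gradedOrder : MonomialOrder (Fin 2) where
  syn := (MonomialOrder.degLex (σ := (Fin 2)ᵒᵈ)).syn
  toSyn := (Finsupp.domCongr OrderDual.toDual).trans
    (MonomialOrder.degLex (σ := (Fin 2)ᵒᵈ)).toSyn
  toSyn_monotone := by
    intro a b h
    refine (MonomialOrder.degLex (σ := (Fin 2)ᵒᵈ)).toSyn_monotone ?_
    intro i
    exact h (OrderDual.ofDual i)

theorem gradedOrder_lt_iff (a b : Idx) :
    (a ≺[gradedOrder] b) ↔ (a 0 + a 1 < b 0 + b 1 ∨ (a 0 + a 1 = b 0 + b 1 ∧ a 1 < b 1)) := by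
  change (toDegLex (Finsupp.domCongr OrderDual.toDual a) : DegLex ((Fin 2)ᵒᵈ →₀ ℕ)) <
    toDegLex (Finsupp.domCongr OrderDual.toDual b) ↔ _
  rw [Finsupp.DegLex.lt_iff]
  have key : ∀ c : Idx, (ofDegLex (toDegLex
      (Finsupp.domCongr (OrderDual.toDual (α := Fin 2)) c))).degree = c 0 + c 1 := by
    intro c
    simp only [ofDegLex_toDegLex]
    rw [Finsupp.degree_eq_sum, ← (OrderDual.toDual (α := Fin 2)).sum_comp]
    simp [Fin.sum_univ_two, Finsupp.domCongr]
  rw [key, key]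
  refine or_congr Iff.rfl (and_congr_right fun h => ?_)
  rw [Finsupp.Lex.lt_iff]
  simp [Finsupp.domCongr, Fin.exists_fin_two, Fin.forall_fin_two, OrderDual.exists,
    OrderDual.forall]
  constructor
  · rintro (⟨h, h'⟩ | ⟨h, h'⟩)
    · have := h (by decide)
      omega
    · exact h'
  · intro h'
    right
    exact ⟨fun hh => absurd hh (by decide), h'⟩

variable {L : Type*} [Field L]

/-- `f[U]_n`, where `s = LP(f)` is the leading exponent of `f`: it is `∑ₘ fₘ u_{m+n-s}` if `s ≤ n`
and `0` otherwise. -/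
def recEval (ord : MonomialOrder (Fin 2)) (U : Idx → L) (f : MvPolynomial (Fin 2) L) (n : Idx) : L :=
  open Classical in
  if ord.degree f ≤ n then ∑ m ∈ f.support, f.coeff m * U (m + (n - ord.degree f)) else 0

/-- `Λ(u^l)`: the polynomials `f` with `f[U]_k = 0` for all `k` with `LP(f) ≤ k` and `k <_T l`. -/
def generating (ord : MonomialOrder (Fin 2)) (U : Idx → L) (l : Idx) :
    Set (MvPolynomial (Fin 2) L) :=
  {f | ∀ k : Idx, ord.degree f ≤ k → k ≺[ord] l → recEval ord U f k = 0}

/-- `Λ(U)`: the polynomials `f` with `f[U]_k = 0` for all `k`. -/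
def generatingAll (ord : MonomialOrder (Fin 2)) (U : Idx → L) : Set (MvPolynomial (Fin 2) L) :=
  {f | ∀ k : Idx, recEval ord U f k = 0}

/-- `F` is a Groebner basis of the ideal `Λ(U)`. -/
def IsGroebnerBasis (ord : MonomialOrder (Fin 2)) (U : Idx → L)
    (F : Set (MvPolynomial (Fin 2) L)) : Prop :=
  F.Finite ∧ F ⊆ generatingAll ord U ∧
    ∀ p ∈ generatingAll ord U, p ≠ 0 → ∃ f ∈ F, f ≠ 0 ∧ ord.degree f ≤ ord.degree p

/-- The syndrome table afforded by `τ` and `e`: `u_n = e(α^{τ+n})`. -/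
def syndromeTable {K : Type*} [Field K] [Algebra K L] (α : Fin 2 → L) (τ : Idx)
    (e : MvPolynomial (Fin 2) K) : Idx → L :=
  fun n => MvPolynomial.aeval (fun i => α i ^ (τ i + n i)) e

/-- The index set `ℤ_{r₁} × ℤ_{r₂}`, through canonical representatives. -/
def indexBox (r : Fin 2 → ℕ) : Set Idx := {n | ∀ i, n i < r i}

/-- The hyperbolic set `B(δ)`. -/
def hyperbolicSet (r : Fin 2 → ℕ) (δ : ℕ) : Set Idx :=
  {n | n ∈ indexBox r ∧ (n 0 + 1) * (n 1 + 1) ≤ δ} \ {pt (δ - 1) 0, pt 0 (δ - 1)}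

/-- The footprint determined by a set `F` of polynomials: the indices that lie above no leading
exponent of a member of `F`. If the leading exponents `s⁽¹⁾, …, s⁽ᵈ⁾` of `F` satisfy
`s₁⁽¹⁾ > ⋯ > s₁⁽ᵈ⁾ = 0` and `0 = s₂⁽¹⁾ < ⋯ < s₂⁽ᵈ⁾`, then these are the `n` with
`n ≤ (s₁⁽ⁱ⁾ - 1, s₂⁽ⁱ⁺¹⁾ - 1)` for some `1 ≤ i < d`. -/
def footprint (ord : MonomialOrder (Fin 2)) (F : Set (MvPolynomial (Fin 2) L)) : Set Idx :=
  {n | ∀ f ∈ F, ¬ ord.degree f ≤ n}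

/-- The footprint after the step at `l`: every `f ∈ F` with `f[U]_l ≠ 0` contributes all indices
below `l - LP(f)`. -/
def newFootprint (ord : MonomialOrder (Fin 2)) (U : Idx → L) (l : Idx)
    (F : Set (MvPolynomial (Fin 2) L)) : Set Idx :=
  footprint ord F ∪ {n | ∃ f ∈ F, recEval ord U f l ≠ 0 ∧ n ≤ l - ord.degree f}

/-- The possible new polynomials `h` with leading exponent `r` in the step at `l`. Here `f ∈ F` with
`LP(f) = s ≤ r`. If `f[U]_l = 0`, or if `r ≤ l` does not hold, then `h = X^{r-s} f` (in particular
`h = f` if `r = s`); otherwise `h` is obtained by the Berlekamp procedure from `f` and some `g ∈ G`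
with associated index `k`, namely
`h = X^{r-s} f - (f[U]_l / g[U]_k) X^{r-l+k-LP(g)} g`, which requires `l - r ≤ k - LP(g)`. -/
def IsReplacement (ord : MonomialOrder (Fin 2)) (U : Idx → L) (l : Idx)
    (F : Set (MvPolynomial (Fin 2) L)) (G : Set (MvPolynomial (Fin 2) L × Idx))
    (r : Idx) (h : MvPolynomial (Fin 2) L) : Prop :=
  ∃ f ∈ F, ord.degree f ≤ r ∧
    (((recEval ord U f l = 0 ∨ ¬ r ≤ l) ∧
        h = MvPolynomial.monomial (r - ord.degree f) 1 * f) ∨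
      (recEval ord U f l ≠ 0 ∧ r ≤ l ∧
        ∃ g k, (g, k) ∈ G ∧ l - r ≤ k - ord.degree g ∧
          h = MvPolynomial.monomial (r - ord.degree f) 1 * f
            - MvPolynomial.C (recEval ord U f l / recEval ord U g k)
              * (MvPolynomial.monomial ((k - ord.degree g) - (l - r)) 1 * g)))

/-- One step of the Berlekamp-Massey-Sakata algorithm, at the index `l`, from `(F, G)` to
`(F', G')`. The members of `G` are polynomials `g` together with their associated index `k`.
The new set `F'` has exactly one polynomial for each minimal index outside the new footprint. The new
set `G'` has one polynomial for each maximal index `c = k - LP(g)` of the new footprint: the old one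
if `c` is in the old footprint, and otherwise an `f ∈ F` with `f[U]_l ≠ 0` and `l - LP(f) = c`, whose
associated index is `l`. -/
structure Step (ord : MonomialOrder (Fin 2)) (U : Idx → L) (l : Idx)
    (F : Set (MvPolynomial (Fin 2) L)) (G : Set (MvPolynomial (Fin 2) L × Idx))
    (F' : Set (MvPolynomial (Fin 2) L)) (G' : Set (MvPolynomial (Fin 2) L × Idx)) : Prop where
  F_update : ∃ φ : Idx → MvPolynomial (Fin 2) L,
    (∀ r, Minimal (· ∉ newFootprint ord U l F) r → IsReplacement ord U l F G r (φ r)) ∧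
      F' = φ '' {r | Minimal (· ∉ newFootprint ord U l F) r}
  G_update : G' =
    {p | p ∈ G ∧ Maximal (· ∈ newFootprint ord U l F) (p.2 - ord.degree p.1)} ∪
      {p | p.1 ∈ F ∧ p.2 = l ∧ recEval ord U p.1 l ≠ 0 ∧ l - ord.degree p.1 ∉ footprint ord F ∧
        Maximal (· ∈ newFootprint ord U l F) (l - ord.degree p.1)}

/-- The stages of the algorithm on the index set `B` that come after the stage `l`: the `k ∈ B` with
`l <_T k`, and the stage `⊤` reached when all indices of `B` have been treated. -/
def laterStages (ord : MonomialOrder (Fin 2)) (B : Set Idx) (l : Idx) : Set (WithTop Idx) :=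
  {n | n = ⊤ ∨ ∃ k ∈ B, l ≺[ord] k ∧ n = (k : WithTop Idx)}

/-- `n` is the stage that follows immediately after the stage `l`: the least `k ∈ B` with `l <_T k`
if there is one, and `⊤` otherwise. -/
def IsNext (ord : MonomialOrder (Fin 2)) (B : Set Idx) (l : Idx) (n : WithTop Idx) : Prop :=
  n ∈ laterStages ord B l ∧
    ∀ m ∈ B, l ≺[ord] m → ∃ k : Idx, n = (k : WithTop Idx) ∧ k ≼[ord] m

/-- A run of the algorithm on the index set `B`, taken in the order `<_T`. Here `F l` and `G l`
(for `l ∈ B`) are the sets `F_l` and `G_l` with which the step at `l` begins, and `F ⊤`, `G ⊤` are the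
sets obtained in the end. -/
structure IsRun (ord : MonomialOrder (Fin 2)) (B : Set Idx) (U : Idx → L)
    (F : WithTop Idx → Set (MvPolynomial (Fin 2) L))
    (G : WithTop Idx → Set (MvPolynomial (Fin 2) L × Idx)) : Prop where
  init_F : F ((0 : Idx) : WithTop Idx) = {1}
  init_G : G ((0 : Idx) : WithTop Idx) = ∅
  step : ∀ k ∈ B, ∀ n, IsNext ord B k n → Step ord U k (F k) (G k) (F n) (G n)

/-- `(F, G)` describes the stages after `l` of a run of the algorithm on `B` that is resumed, just
after the step at `l`, with the sets `F₀` and `G₀`. -/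
structure IsResumedRun (ord : MonomialOrder (Fin 2)) (B : Set Idx) (U : Idx → L) (l : Idx)
    (F₀ : Set (MvPolynomial (Fin 2) L)) (G₀ : Set (MvPolynomial (Fin 2) L × Idx))
    (F : WithTop Idx → Set (MvPolynomial (Fin 2) L))
    (G : WithTop Idx → Set (MvPolynomial (Fin 2) L × Idx)) : Prop where
  init_F : ∀ n, IsNext ord B l n → F n = F₀
  init_G : ∀ n, IsNext ord B l n → G n = G₀
  step : ∀ k ∈ B, l ≺[ord] k → ∀ n, IsNext ord B k n → Step ord U k (F k) (G k) (F n) (G n)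

/-- `h_c = p - (c / v) g`. -/
def corrected (p g : MvPolynomial (Fin 2) L) (v c : L) : MvPolynomial (Fin 2) L :=
  p - MvPolynomial.C (c / v) * g

end BMS

end

/-! Write L_x(f) = ∑ₘ fₘ u_{m+x} (`shiftEval`), so that f[U] at LP(f) + x is L_x(f), and let D be
the footprint of Λ(U) (`limitFootprint`). Three facts make the algorithm on B correct. If x ∉ D,
some nonzero q ∈ Λ(U) has LP(q) ≤ x, and the recurrence given by q expresses L_x(f) through values
L_y(f) with y <_T x (`shiftEval_eq_zero_of_notMem`). Hence f only has to be tested at the indices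
LP(f) + j with j ∈ D. The table is a sum of at most t exponential terms, so |D| ≤ t
(`limitFootprint_syndromeTable`). For t ≤ 4, s + D ⊆ B whenever s is minimal outside a subset of D
(`add_mem_hyperbolicSet`). Skipping the indices outside B therefore loses nothing: at every stage
the members of F vanish at all earlier indices of ℕ², and the footprint of F stays inside D
(`Invariant.step`). At the end F is a Groebner basis.

In the exceptional cases the footprint of F_l contains t collinear points, so it already equals D
and is a rectangle {x ≤ c}. It cannot grow any more: G is frozen at one polynomial g, and F keeps
two members with fixed leading exponents. For r = LP(p) one has l = r + c, so the correction of p at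
l is a scalar multiple of g. No later index of B lies above r, so the corrected polynomial is never
tested or changed again, while the other member is updated from itself and g alone. This gives the
independence of b (`step_pair_iff`, `exceptional_run`). -/

noncomputable section

namespace BMS

variable {L : Type*} [Field L]

/-! ### Shifted functionals and the footprint of Λ(U) -/

/-- The linear functional `f ↦ ∑ₘ fₘ u_{m+x}`. -/
def shiftEval (U : Idx → L) (x : Idx) : MvPolynomial (Fin 2) L →ₗ[L] L :=
  (MvPolynomial.basisMonomials (Fin 2) L).constr L fun m => U (m + x)

theorem shiftEval_apply (U : Idx → L) (x : Idx) (f : MvPolynomial (Fin 2) L) :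
    shiftEval U x f = ∑ m ∈ f.support, f.coeff m * U (m + x) := by
  rw [shiftEval, Module.Basis.constr_apply]
  rfl

theorem shiftEval_monomial (U : Idx → L) (x m : Idx) (a : L) :
    shiftEval U x (MvPolynomial.monomial m a) = a * U (m + x) := by
  classical
  rw [shiftEval_apply]
  by_cases ha : a = 0
  · simp [ha]
  · simp [MvPolynomial.support_monomial, ha]

theorem shiftEval_monomial_mul (U : Idx → L) (x y : Idx) (f : MvPolynomial (Fin 2) L) :
    shiftEval U x (MvPolynomial.monomial y 1 * f) = shiftEval U (y + x) f := by
  suffices h : shiftEval U x ∘ₗ LinearMap.mulLeft L (MvPolynomial.monomial y 1) =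
      shiftEval U (y + x) from LinearMap.congr_fun h f
  refine (MvPolynomial.basisMonomials (Fin 2) L).ext fun m => ?_
  simp only [MvPolynomial.coe_basisMonomials, LinearMap.comp_apply, LinearMap.mulLeft_apply,
    MvPolynomial.monomial_mul, shiftEval_monomial, one_mul]
  rw [show y + m + x = m + (y + x) by abel]

theorem shiftEval_C_mul (U : Idx → L) (x : Idx) (a : L) (f : MvPolynomial (Fin 2) L) :
    shiftEval U x (MvPolynomial.C a * f) = a * shiftEval U x f := by
  rw [MvPolynomial.C_mul', map_smul, smul_eq_mul]

/-- Both sides are ∑ qᵢ fⱼ u_{i+j+x}. For q ∈ Λ(U) the right side vanishes, which turns q into a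
linear recurrence for the values of f. -/
theorem sum_coeff_mul_shiftEval (U : Idx → L) (x : Idx) (f q : MvPolynomial (Fin 2) L) :
    ∑ m ∈ q.support, q.coeff m * shiftEval U (m + x) f =
      ∑ m ∈ f.support, f.coeff m * shiftEval U (m + x) q := by
  simp only [shiftEval_apply, Finset.mul_sum]
  rw [Finset.sum_comm]
  refine Finset.sum_congr rfl fun i _ => Finset.sum_congr rfl fun j _ => ?_
  rw [show j + (i + x) = i + (j + x) by abel]
  ring

variable {ord : MonomialOrder (Fin 2)} {U : Idx → L}

theorem recEval_of_le {f : MvPolynomial (Fin 2) L} {n : Idx} (h : ord.degree f ≤ n) :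
    recEval ord U f n = shiftEval U (n - ord.degree f) f := by
  rw [recEval, if_pos h, shiftEval_apply]

theorem recEval_of_not_le {f : MvPolynomial (Fin 2) L} {n : Idx} (h : ¬ ord.degree f ≤ n) :
    recEval ord U f n = 0 := by
  rw [recEval, if_neg h]

theorem le_of_recEval_ne_zero {f : MvPolynomial (Fin 2) L} {n : Idx}
    (h : recEval ord U f n ≠ 0) : ord.degree f ≤ n := by
  by_contra hn
  exact h (recEval_of_not_le hn)

theorem recEval_add (f : MvPolynomial (Fin 2) L) (x : Idx) :
    recEval ord U f (ord.degree f + x) = shiftEval U x f := by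
  rw [recEval_of_le le_self_add, add_tsub_cancel_left]

theorem mem_generatingAll {f : MvPolynomial (Fin 2) L} :
    f ∈ generatingAll ord U ↔ ∀ x, shiftEval U x f = 0 := by
  refine ⟨fun h x => ?_, fun h k => ?_⟩
  · rw [← recEval_add (ord := ord)]
    exact h _
  · by_cases hk : ord.degree f ≤ k
    · rw [recEval_of_le hk, h]
    · exact recEval_of_not_le hk

variable (ord U) in
/-- The indices below no leading exponent of a nonzero element of `Λ(U)`. -/
def limitFootprint : Set Idx := footprint ord {q | q ∈ generatingAll ord U ∧ q ≠ 0}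

theorem isLowerSet_footprint (F : Set (MvPolynomial (Fin 2) L)) :
    IsLowerSet (footprint ord F) :=
  fun _ _ hab ha f hf hfb => ha f hf (hfb.trans hab)

theorem isLowerSet_limitFootprint : IsLowerSet (limitFootprint ord U) :=
  isLowerSet_footprint _

/-- Modulo `Λ(U)`, a monomial outside the limit footprint is a combination of smaller ones. -/
theorem shiftEval_eq_zero_of_notMem {f : MvPolynomial (Fin 2) L} {x : Idx}
    (hx : x ∉ limitFootprint ord U) (h : ∀ y, y ≺[ord] x → shiftEval U y f = 0) :
    shiftEval U x f = 0 := by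
  simp only [limitFootprint, footprint, Set.mem_ofPred_eq, not_forall, not_not] at hx
  obtain ⟨q, ⟨hq, hq0⟩, hqx⟩ := hx
  have h1 := sum_coeff_mul_shiftEval U (x - ord.degree q) f q
  rw [mem_generatingAll] at hq
  simp only [hq, mul_zero, Finset.sum_const_zero] at h1
  -- The non-leading terms of q only involve shifts smaller than x, where f vanishes by assumption;
  -- the leading coefficient of q can then be cancelled.
  rw [Finset.sum_eq_single_of_mem (ord.degree q) (ord.degree_mem_support hq0)] at h1
  · rw [add_tsub_cancel_of_le hqx] at h1
    exact (mul_eq_zero.1 h1).resolve_left (ord.leadingCoeff_ne_zero_iff.2 hq0)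
  · intro m hm hne
    rw [h, mul_zero]
    have hlt : m ≺[ord] ord.degree q :=
      lt_of_le_of_ne (ord.le_degree hm) fun he => hne (ord.toSyn.injective he)
    calc ord.toSyn (m + (x - ord.degree q))
        < ord.toSyn (ord.degree q + (x - ord.degree q)) := by
          rw [map_add, map_add]
          gcongr
      _ = ord.toSyn x := by rw [add_tsub_cancel_of_le hqx]

/-- Well-founded induction along the monomial order; `P` cuts out an initial segment, so points
outside D follow from smaller ones. -/
theorem shiftEval_eq_zero_of_forall_mem {f : MvPolynomial (Fin 2) L} {P : Idx → Prop}
    (hP : ∀ x y, y ≺[ord] x → P x → P y)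
    (h : ∀ y ∈ limitFootprint ord U, P y → shiftEval U y f = 0) (x : Idx) (hx : P x) :
    shiftEval U x f = 0 := by
  induction hn : ord.toSyn x using WellFoundedLT.induction generalizing x with
  | _ s ih =>
    subst hn
    by_cases hxD : x ∈ limitFootprint ord U
    · exact h x hxD hx
    · exact shiftEval_eq_zero_of_notMem hxD fun y hy => ih _ hy y (hP x y hy hx) rfl

/-! ### Size of the limit footprint of a syndrome table -/

/-- A table of the form `u_n = ∑ₘ wₘ Pₘⁿ` with at most `t` terms has a limit footprint with at most
`t` elements. -/
theorem card_le_of_subset_limitFootprint {ι : Type*} (s : Finset ι) (w : ι → L)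
    (P : ι → Fin 2 → L)
    (hU : ∀ n, U n = ∑ i ∈ s, w i * MvPolynomial.eval (P i) (MvPolynomial.monomial n 1))
    (T : Finset Idx) (hT : (T : Set Idx) ⊆ limitFootprint ord U) : T.card ≤ s.card := by
  classical
  by_contra! hlt
  -- `M` evaluates the polynomials supported on `T` at the points `P i`. If `T` has more elements
  -- than there are points, a nonzero one vanishes at all of them; it lies in Λ(U), yet its leading
  -- exponent belongs to `T`.
  let M : (T → L) →ₗ[L] (s → L) :=
    { toFun := fun a i => ∑ x : T, a x * MvPolynomial.eval (P i) (MvPolynomial.monomial x.1 1)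
      map_add' := fun a b => by
        ext i
        simp [add_mul, Finset.sum_add_distrib]
      map_smul' := fun a b => by
        ext i
        simp [Finset.mul_sum, mul_assoc] }
  obtain ⟨a, ha, ha0⟩ := Submodule.exists_mem_ne_zero_of_ne_bot
    (LinearMap.ker_ne_bot_of_finrank_lt (f := M) (by simpa using hlt))
  let q : MvPolynomial (Fin 2) L := ∑ x : T, MvPolynomial.monomial x.1 (a x)
  have hcoeff : ∀ y : T, q.coeff y = a y := by
    intro y
    simp only [q, MvPolynomial.coeff_sum, MvPolynomial.coeff_monomial]
    rw [Finset.sum_eq_single y (fun z _ hz => if_neg fun h => hz (Subtype.ext h)) (by simp)]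
    simp
  have hsupp : ∀ y ∈ q.support, y ∈ T := by
    intro y hy
    by_contra hyT
    refine MvPolynomial.mem_support_iff.1 hy ?_
    simp only [q, MvPolynomial.coeff_sum, MvPolynomial.coeff_monomial]
    refine Finset.sum_eq_zero fun z _ => if_neg fun h => hyT ?_
    rw [← h]
    exact z.2
  have hq0 : q ≠ 0 := by
    intro h
    refine ha0 (funext fun y => ?_)
    rw [← hcoeff, h]
    simp
  have heval : ∀ i ∈ s, MvPolynomial.eval (P i) q = 0 := by
    intro i hi
    have h1 := congrFun (LinearMap.mem_ker.1 ha) ⟨i, hi⟩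
    simp only [M, LinearMap.coe_mk, AddHom.coe_mk, Pi.zero_apply] at h1
    rw [← h1, map_sum]
    refine Finset.sum_congr rfl fun x _ => ?_
    simp [MvPolynomial.eval_monomial]
  refine hT (hsupp _ (ord.degree_mem_support hq0)) q ⟨mem_generatingAll.2 fun x => ?_, hq0⟩ le_rfl
  have key : shiftEval U x q = ∑ i ∈ s, w i *
      (MvPolynomial.eval (P i) (MvPolynomial.monomial x 1) * MvPolynomial.eval (P i) q) := by
    rw [shiftEval_apply]
    simp only [MvPolynomial.eval_eq' (P _) q, hU, Finset.mul_sum]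
    rw [Finset.sum_comm]
    refine Finset.sum_congr rfl fun i _ => Finset.sum_congr rfl fun m _ => ?_
    simp only [MvPolynomial.eval_monomial, Finsupp.prod_fintype, pow_zero, implies_true, one_mul,
      Finsupp.add_apply, pow_add, Finset.prod_mul_distrib]
    ring
  rw [key]
  exact Finset.sum_eq_zero fun i hi => by rw [heval i hi, mul_zero, mul_zero]

theorem syndromeTable_eq_sum {K : Type*} [Field K] [Algebra K L] (α : Fin 2 → L) (τ : Idx)
    (e : MvPolynomial (Fin 2) K) (n : Idx) :
    syndromeTable α τ e n = ∑ m ∈ e.support,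
      (algebraMap K L (e.coeff m) * ∏ i, (α i ^ m i) ^ τ i) *
        MvPolynomial.eval (fun i => α i ^ m i) (MvPolynomial.monomial n 1) := by
  rw [syndromeTable, MvPolynomial.aeval_def, MvPolynomial.eval₂_eq']
  refine Finset.sum_congr rfl fun m _ => ?_
  rw [MvPolynomial.eval_monomial, Finsupp.prod_fintype _ _ (by simp), one_mul, mul_assoc,
    ← Finset.prod_mul_distrib]
  congr 1
  refine Finset.prod_congr rfl fun i _ => ?_
  rw [← pow_add, ← pow_mul, ← pow_mul, mul_comm]

theorem limitFootprint_syndromeTable {K : Type*} [Field K] [Algebra K L] (α : Fin 2 → L)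
    (τ : Idx) (e : MvPolynomial (Fin 2) K) :
    (limitFootprint ord (syndromeTable α τ e)).Finite ∧
      (limitFootprint ord (syndromeTable α τ e)).ncard ≤ e.support.card := by
  have h := card_le_of_subset_limitFootprint (ord := ord) e.support _ _
    (syndromeTable_eq_sum α τ e)
  have hfin : (limitFootprint ord (syndromeTable α τ e)).Finite := by
    by_contra hinf
    obtain ⟨T, hT, hc⟩ := Set.Infinite.exists_subset_card_eq hinf (e.support.card + 1)
    have := h T hT
    omega
  refine ⟨hfin, ?_⟩
  rw [Set.ncard_eq_toFinset_card _ hfin]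
  exact h _ (by simp)

/-! ### Rectangles in ℕ² and the hyperbolic set -/

theorem Idx.le_iff {a b : Idx} : a ≤ b ↔ a 0 ≤ b 0 ∧ a 1 ≤ b 1 := by
  rw [Finsupp.le_def, Fin.forall_fin_two]

theorem Idx.ext_iff {a b : Idx} : a = b ↔ a 0 = b 0 ∧ a 1 = b 1 := by
  rw [Finsupp.ext_iff, Fin.forall_fin_two]

@[simp] theorem pt_zero (a b : ℕ) : pt a b 0 = a := by simp [pt]

@[simp] theorem pt_one (a b : ℕ) : pt a b 1 = b := by simp [pt]

theorem Idx.card_Iic (a : Idx) : (Finset.Iic a).card = (a 0 + 1) * (a 1 + 1) := by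
  rw [Finsupp.card_Iic, Finset.prod_subset (Finset.subset_univ _), Fin.prod_univ_two]
  · simp
  · intro i _ hi
    simp [Finsupp.notMem_support_iff.1 hi]

/-- Inclusion–exclusion for the two rectangles below x and y, both contained in D. -/
theorem card_union_le_ncard {D : Set Idx} (hD : IsLowerSet D) (hfin : D.Finite)
    {x y : Idx} (hx : x ∈ D) (hy : y ∈ D) :
    (x 0 + 1) * (x 1 + 1) + (y 0 + 1) * (y 1 + 1) ≤
      D.ncard + (min (x 0) (y 0) + 1) * (min (x 1) (y 1) + 1) := by
  classical
  have h1 : (Finset.Iic x ∪ Finset.Iic y).card ≤ D.ncard := by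
    rw [Set.ncard_eq_toFinset_card _ hfin]
    refine Finset.card_le_card fun z hz => ?_
    rw [Set.Finite.mem_toFinset]
    rcases Finset.mem_union.1 hz with h | h
    · exact hD (Finset.mem_Iic.1 h) hx
    · exact hD (Finset.mem_Iic.1 h) hy
  have h2 : Finset.Iic x ∩ Finset.Iic y = Finset.Iic (pt (min (x 0) (y 0)) (min (x 1) (y 1))) := by
    ext z
    simp only [Finset.mem_inter, Finset.mem_Iic, Idx.le_iff, pt_zero, pt_one]
    omega
  have h3 := Finset.card_union_add_card_inter (Finset.Iic x) (Finset.Iic y)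
  rw [h2, Idx.card_Iic, Idx.card_Iic, Idx.card_Iic, pt_zero, pt_one] at h3
  omega

theorem card_Iic_le_ncard {D : Set Idx} (hD : IsLowerSet D) (hfin : D.Finite)
    {x : Idx} (hx : x ∈ D) : (x 0 + 1) * (x 1 + 1) ≤ D.ncard := by
  have := card_union_le_ncard hD hfin hx hx
  simp only [min_self] at this
  omega

theorem pred_mem_of_minimal {N : Set Idx} {s : Idx} (hs : Minimal (· ∉ N) s) {x : Idx}
    (hx : x ≤ s) (hne : x ≠ s) : x ∈ N := by
  by_contra h
  exact hne (hs.eq_of_le h hx)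

/-- Here (a, b) is a minimal point outside the smaller footprint and (i, j) a point of D. The
hypotheses count the rectangles below (i, j), (a - 1, b), (a, b - 1) and their unions inside a set
of at most t points. The bound fails for t = 5, with (a, b) = (2, 1) and (i, j) = (1, 1). -/
theorem hyperbolic_bound {t a b i j : ℕ} (ht : t ≤ 4) (hij : (i + 1) * (j + 1) ≤ t)
    (ha : a ≠ 0 → a * (b + 1) + (i + 1) * (j + 1) ≤ t + (min (a - 1) i + 1) * (min b j + 1))
    (hb : b ≠ 0 → (a + 1) * b + (i + 1) * (j + 1) ≤ t + (min a i + 1) * (min (b - 1) j + 1))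
    (ha' : a ≠ 0 → a * (b + 1) ≤ t) (hb' : b ≠ 0 → (a + 1) * b ≤ t)
    (hab : a ≠ 0 → b ≠ 0 → a * (b + 1) + (a + 1) * b ≤ t + a * b) :
    (a + i + 1) * (b + j + 1) ≤ 2 * t + 1 ∧ a + i < 2 * t ∧ b + j < 2 * t := by
  have hi : i ≤ 3 := by nlinarith
  have hj : j ≤ 3 := by nlinarith
  have ha4 : a ≤ 4 := by
    by_contra h
    have := ha' (by omega)
    nlinarith
  have hb4 : b ≤ 4 := by
    by_contra h
    have := hb' (by omega)
    nlinarith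
  -- All parameters are now bounded, which leaves a finite check; `ha'` and `hb'` served only to
  -- bound a and b.
  have key : ∀ t a b : Fin 5, ∀ i j : Fin 4, (i + 1 : ℕ) * (j + 1) ≤ t →
      (a.1 ≠ 0 → a * (b + 1 : ℕ) + (i + 1) * (j + 1) ≤ t + (min (a.1 - 1) i.1 + 1) * (min b.1 j + 1)) →
      (b.1 ≠ 0 → (a + 1 : ℕ) * b + (i + 1) * (j + 1) ≤ t + (min a.1 i + 1) * (min (b.1 - 1) j.1 + 1)) →
      (a.1 ≠ 0 → b.1 ≠ 0 → a * (b + 1 : ℕ) + (a + 1) * b ≤ t + a * b) →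
      (a.1 + i + 1) * (b.1 + j + 1) ≤ 2 * t + 1 ∧ a.1 + i < 2 * t.1 ∧ b.1 + j < 2 * t.1 := by
    decide +kernel
  exact key ⟨t, by omega⟩ ⟨a, by omega⟩ ⟨b, by omega⟩ ⟨i, by omega⟩ ⟨j, by omega⟩ hij ha hb hab

/-- The combinatorial reason for the choice of the set `B(2t+1)`. -/
theorem add_mem_hyperbolicSet {r : Fin 2 → ℕ} {t : ℕ} (ht4 : t ≤ 4) (htr : ∀ i, t ≤ r i / 2)
    {D N : Set Idx} (hD : IsLowerSet D) (hfin : D.Finite) (hcard : D.ncard ≤ t) (hND : N ⊆ D)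
    {s j : Idx} (hs : Minimal (· ∉ N) s) (hj : j ∈ D) :
    s + j ∈ hyperbolicSet r (2 * t + 1) := by
  have hl : s 0 ≠ 0 → pt (s 0 - 1) (s 1) ∈ D := fun h => hND <| pred_mem_of_minimal hs
    (by rw [Idx.le_iff]; simp) (by rw [Ne, Idx.ext_iff]; simp; omega)
  have hr : s 1 ≠ 0 → pt (s 0) (s 1 - 1) ∈ D := fun h => hND <| pred_mem_of_minimal hs
    (by rw [Idx.le_iff]; simp) (by rw [Ne, Idx.ext_iff]; simp; omega)
  have key := hyperbolic_bound (a := s 0) (b := s 1) ht4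
    ((card_Iic_le_ncard hD hfin hj).trans hcard)
    (fun h => by
      have := card_union_le_ncard hD hfin (hl h) hj
      simp only [pt_zero, pt_one, Nat.sub_add_cancel (Nat.pos_of_ne_zero h)] at this
      omega)
    (fun h => by
      have := card_union_le_ncard hD hfin (hr h) hj
      simp only [pt_zero, pt_one, Nat.sub_add_cancel (Nat.pos_of_ne_zero h)] at this
      omega)
    (fun h => by
      have := card_Iic_le_ncard hD hfin (hl h)
      simp only [pt_zero, pt_one, Nat.sub_add_cancel (Nat.pos_of_ne_zero h)] at this
      omega)
    (fun h => by
      have := card_Iic_le_ncard hD hfin (hr h)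
      simp only [pt_zero, pt_one, Nat.sub_add_cancel (Nat.pos_of_ne_zero h)] at this
      omega)
    (fun h h' => by
      have := card_union_le_ncard hD hfin (hl h) (hr h')
      simp only [pt_zero, pt_one, Nat.sub_add_cancel (Nat.pos_of_ne_zero h),
        Nat.sub_add_cancel (Nat.pos_of_ne_zero h'), min_eq_left (Nat.sub_le _ _),
        min_eq_right (Nat.sub_le _ _)] at this
      omega)
  -- These give 2t ≤ rᵢ, so the coordinate bounds below 2t both place the sum in the box and exclude
  -- the two removed corners.
  have h0 := htr 0
  have h1 := htr 1
  refine ⟨⟨?_, by simpa using key.1⟩, ?_⟩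
  · refine Fin.forall_fin_two.2 ⟨?_, ?_⟩ <;> simp only [Finsupp.add_apply] <;> omega
  · rintro (h | h)
    · have := congrArg (· 0) h
      simp at this
      omega
    · have := congrArg (· 1) h
      simp at this
      omega

theorem finite_hyperbolicSet (r : Fin 2 → ℕ) (δ : ℕ) : (hyperbolicSet r δ).Finite := by
  refine (Set.finite_Iic (pt (r 0) (r 1))).subset fun n hn => ?_
  have h := hn.1.1
  rw [Set.mem_Iic, Idx.le_iff, pt_zero, pt_one]
  exact ⟨(h 0).le, (h 1).le⟩

/-! ### Footprints and minimal elements of their complements -/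

theorem exists_minimal_notMem_le {N : Set Idx} {x : Idx} (hx : x ∉ N) :
    ∃ s ≤ x, Minimal (· ∉ N) s :=
  exists_minimal_le_of_wellFoundedLT _ x hx

/-- Dickson's lemma: antichains in ℕ² are finite. -/
theorem finite_minimal_notMem (N : Set Idx) : {s | Minimal (· ∉ N) s}.Finite :=
  (setOfPred_minimal_antichain (· ∉ N)).finite_of_wellQuasiOrdered wellQuasiOrdered_le

theorem footprint_eq_of_degree_image {F : Set (MvPolynomial (Fin 2) L)} {N : Set Idx}
    (hN : IsLowerSet N) (h : ord.degree '' F = {s | Minimal (· ∉ N) s}) :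
    footprint ord F = N := by
  ext x
  constructor
  · intro hx
    by_contra hxN
    obtain ⟨s, hsx, hs⟩ := exists_minimal_notMem_le hxN
    obtain ⟨f, hf, rfl⟩ : s ∈ ord.degree '' F := h ▸ hs
    exact hx f hf hsx
  · intro hx f hf hfx
    have : ord.degree f ∈ {s | Minimal (· ∉ N) s} := h ▸ Set.mem_image_of_mem _ hf
    exact this.1 (hN hfx hx)

theorem isLowerSet_newFootprint (l : Idx) (F : Set (MvPolynomial (Fin 2) L)) :
    IsLowerSet (newFootprint ord U l F) := by
  refine (isLowerSet_footprint F).union ?_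
  rintro a b hab ⟨f, hf, h0, h⟩
  exact ⟨f, hf, h0, hab.trans h⟩

/-! ### Order and induction on the stages -/

/-- `k` precedes the stage `n`. -/
def Before (ord : MonomialOrder (Fin 2)) (k : Idx) (n : WithTop Idx) : Prop :=
  ∀ m : Idx, n = m → k ≺[ord] m

theorem before_top (k : Idx) : Before ord k ⊤ := by
  intro m hm
  exact absurd hm (by simp)

theorem before_coe {k m : Idx} : Before ord k m ↔ k ≺[ord] m :=
  ⟨fun h => h m rfl, fun h _ hm' => WithTop.coe_injective hm' ▸ h⟩

theorem Before.trans_lt {k k' : Idx} {n : WithTop Idx} (h : Before ord k' n) (hk : k ≺[ord] k') :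
    Before ord k n :=
  fun m hm => lt_trans hk (h m hm)

theorem IsNext.before {B : Set Idx} {k : Idx} {n : WithTop Idx} (h : IsNext ord B k n) :
    Before ord k n := by
  rcases h.1 with rfl | ⟨m, -, hm, rfl⟩
  · exact before_top k
  · exact before_coe.2 hm

theorem IsNext.le_of_before {B : Set Idx} {k m : Idx} {n : WithTop Idx} (h : IsNext ord B k n)
    (hm : m ∈ B) (hmn : Before ord m n) : m ≼[ord] k := by
  by_contra! hlt
  obtain ⟨k', rfl, hk'⟩ := h.2 m hm hlt
  exact absurd (before_coe.1 hmn) (not_lt.2 hk')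

theorem exists_isNext {B : Set Idx} (hB : B.Finite) {l : Idx} (hl : l ∈ B) {n : WithTop Idx}
    (hn : n ∈ laterStages ord B l) :
    ∃ k ∈ B, (k = l ∨ l ≺[ord] k) ∧ IsNext ord B k n ∧ Before ord k n := by
  have hln : Before ord l n := by
    rcases hn with rfl | ⟨m, -, hm, rfl⟩
    · exact before_top l
    · exact before_coe.2 hm
  obtain ⟨k, ⟨hkB, hkn⟩, hk⟩ := Set.exists_max_image {k | k ∈ B ∧ Before ord k n} ord.toSyn
    (hB.subset fun k hk => hk.1) ⟨l, hl, hln⟩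
  refine ⟨k, hkB, ?_, ⟨?_, ?_⟩, hkn⟩
  · rcases (hk l ⟨hl, hln⟩).eq_or_lt with h | h
    · exact Or.inl (ord.toSyn.injective h.symm)
    · exact Or.inr h
  · rcases hn with rfl | ⟨m, hm, -, rfl⟩
    · exact Or.inl rfl
    · exact Or.inr ⟨m, hm, before_coe.1 hkn, rfl⟩
  · intro m hm hkm
    by_contra! h
    refine absurd (hk m ⟨hm, fun _ hm' => ?_⟩) (not_le.2 hkm)
    exact h _ hm'

/-- Induction along the stages after `l`. -/
theorem laterStages_induction {B : Set Idx} (hB : B.Finite) {l : Idx} (hl : l ∈ B)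
    {P : WithTop Idx → Prop} (h0 : ∀ n, IsNext ord B l n → P n)
    (hstep : ∀ k ∈ B, l ≺[ord] k → ∀ n, IsNext ord B k n → P k → P n)
    {n : WithTop Idx} (hn : n ∈ laterStages ord B l) : P n := by
  have hcoe : ∀ s : ord.syn, ∀ k ∈ B, l ≺[ord] k → ord.toSyn k = s → P k := by
    intro s
    induction s using WellFoundedLT.induction with
    | _ s ih =>
      rintro k hk hlk rfl
      obtain ⟨m, hm, hlm, hnext, hmk⟩ := exists_isNext hB hl (Or.inr ⟨k, hk, hlk, rfl⟩)
      rcases hlm with rfl | hlm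
      · exact h0 _ hnext
      · exact hstep m hm hlm _ hnext (ih _ (before_coe.1 hmk) m hm hlm rfl)
  obtain ⟨m, hm, hlm, hnext, -⟩ := exists_isNext hB hl hn
  rcases hlm with rfl | hlm
  · exact h0 _ hnext
  · exact hstep m hm hlm _ hnext (hcoe _ m hm hlm rfl)

/-! ### Vanishing, auxiliary polynomials and the Berlekamp procedure -/

/-- `f[U]_k = 0` for all `k` that precede the stage `n`. -/
def VanishesBefore (ord : MonomialOrder (Fin 2)) (U : Idx → L) (n : WithTop Idx)
    (f : MvPolynomial (Fin 2) L) : Prop :=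
  ∀ x, Before ord (ord.degree f + x) n → shiftEval U x f = 0

/-- `g[U]_k ≠ 0`, while `g[U]` vanishes at all indices before `k`. -/
structure IsAux (ord : MonomialOrder (Fin 2)) (U : Idx → L) (g : MvPolynomial (Fin 2) L)
    (k : Idx) : Prop where
  le : ord.degree g ≤ k
  ne_zero : shiftEval U (k - ord.degree g) g ≠ 0
  vanish : VanishesBefore ord U k g

theorem IsAux.recEval_ne_zero {g : MvPolynomial (Fin 2) L} {k : Idx} (h : IsAux ord U g k) :
    recEval ord U g k ≠ 0 := by
  rw [recEval_of_le h.le]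
  exact h.ne_zero

theorem IsAux.poly_ne_zero {g : MvPolynomial (Fin 2) L} {k : Idx} (h : IsAux ord U g k) :
    g ≠ 0 := by
  rintro rfl
  exact h.ne_zero (map_zero _)

/-- A first failure of f cannot occur at a shift outside D, since there the value is forced by the
smaller shifts. This keeps every growth of the footprint inside D. -/
theorem VanishesBefore.sub_mem {l : Idx} {f : MvPolynomial (Fin 2) L}
    (h : VanishesBefore ord U l f) (hl : recEval ord U f l ≠ 0) :
    l - ord.degree f ∈ limitFootprint ord U := by
  have hle := le_of_recEval_ne_zero hl
  rw [recEval_of_le hle] at hl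
  by_contra hD
  refine hl (shiftEval_eq_zero_of_notMem hD fun y hy => h y (before_coe.2 ?_))
  calc ord.toSyn (ord.degree f + y) < ord.toSyn (ord.degree f + (l - ord.degree f)) := by
        rw [map_add, map_add]
        gcongr
    _ = ord.toSyn l := by rw [add_tsub_cancel_of_le hle]

theorem newFootprint_subset {l : Idx} {F : Set (MvPolynomial (Fin 2) L)}
    (hF : footprint ord F ⊆ limitFootprint ord U)
    (hv : ∀ f ∈ F, recEval ord U f l ≠ 0 → VanishesBefore ord U l f) :
    newFootprint ord U l F ⊆ limitFootprint ord U := by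
  rintro x (hx | ⟨f, hf, h0, hx⟩)
  · exact hF hx
  · exact isLowerSet_limitFootprint hx ((hv f hf h0).sub_mem h0)

/-- The gap between l and the next stage may contain indices outside B. They need no test: it
suffices to look at shifts j ∈ D, where LP(h) + j is in B and hence, if it precedes n, is at most l.
-/
theorem vanishesBefore_of_isNext {B : Set Idx} {l : Idx} {n : WithTop Idx}
    (hnext : IsNext ord B l n) {h : MvPolynomial (Fin 2) L}
    (hB : ∀ j ∈ limitFootprint ord U, ord.degree h + j ∈ B)
    (hv : ∀ x, ord.degree h + x ≼[ord] l → shiftEval U x h = 0) : VanishesBefore ord U n h := by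
  refine shiftEval_eq_zero_of_forall_mem (ord := ord) (fun x y hyx hx => hx.trans_lt ?_)
    fun j hj hjn => hv j (hnext.le_of_before (hB j hj) hjn)
  rw [map_add, map_add]
  gcongr

theorem degree_monomial_mul (y : Idx) {f : MvPolynomial (Fin 2) L} (hf : f ≠ 0) :
    ord.degree (MvPolynomial.monomial y 1 * f) = y + ord.degree f := by
  classical
  rw [ord.degree_mul (by simp) hf, ord.degree_monomial, if_neg one_ne_zero]

theorem degree_C_mul_le (a : L) (f : MvPolynomial (Fin 2) L) :
    ord.degree (MvPolynomial.C a * f) ≼[ord] ord.degree f := by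
  rw [MvPolynomial.C_mul']
  exact ord.degree_smul_le

theorem ne_zero_of_degree_sub {f g : MvPolynomial (Fin 2) L}
    (h : ord.degree g ≺[ord] ord.degree f) : f - g ≠ 0 := by
  intro h0
  rw [sub_eq_zero.1 h0] at h
  exact lt_irrefl _ h

/-- The Berlekamp procedure. -/
theorem IsReplacement.spec {l : Idx} {F : Set (MvPolynomial (Fin 2) L)}
    {G : Set (MvPolynomial (Fin 2) L × Idx)} {r : Idx} {h : MvPolynomial (Fin 2) L}
    (hrep : IsReplacement ord U l F G r h)
    (hF0 : ∀ f ∈ F, ord.degree f ≤ r → f ≠ 0)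
    (hFv : ∀ f ∈ F, ord.degree f ≤ r → VanishesBefore ord U l f)
    (hG : ∀ p ∈ G, IsAux ord U p.1 p.2 ∧ p.2 ≺[ord] l) :
    ord.degree h = r ∧ h ≠ 0 ∧ ∀ x, r + x ≼[ord] l → shiftEval U x h = 0 := by
  obtain ⟨f, hf, hfr, hh⟩ := hrep
  have hf0 := hF0 f hf hfr
  have hfv := hFv f hf hfr
  have hdeg : ord.degree (MvPolynomial.monomial (r - ord.degree f) 1 * f) = r := by
    rw [degree_monomial_mul _ hf0, tsub_add_cancel_of_le hfr]
  have hne : MvPolynomial.monomial (r - ord.degree f) 1 * f ≠ 0 := mul_ne_zero (by simp) hf0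
  have hsplit : ∀ x, ord.degree f + (r - ord.degree f + x) = r + x := fun x => by
    rw [← add_assoc, add_tsub_cancel_of_le hfr]
  have hlt : ∀ x, r + x ≺[ord] l → shiftEval U (r - ord.degree f + x) f = 0 := fun x hx =>
    hfv _ (before_coe.2 (by rwa [hsplit]))
  have heq : ∀ x, r + x = l → shiftEval U (r - ord.degree f + x) f = recEval ord U f l :=
    fun x hx => by
      rw [← hx, ← hsplit, recEval_add]
  rcases hh with ⟨hcond, rfl⟩ | ⟨hl0, hrl, g, k, hgG, hle, rfl⟩
  · refine ⟨hdeg, hne, fun x hx => ?_⟩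
    rw [shiftEval_monomial_mul]
    rcases hx.lt_or_eq with hx | hx
    · exact hlt x hx
    · have hx := ord.toSyn.injective hx
      rw [heq x hx]
      exact hcond.resolve_right fun h => h (hx ▸ le_self_add)
  · obtain ⟨haux, hkl⟩ := hG _ hgG
    dsimp only at haux hkl
    obtain ⟨z, rfl⟩ := exists_add_of_le hrl
    obtain ⟨w, hw⟩ := exists_add_of_le haux.le
    have hkw : k - ord.degree g = w := by rw [hw, add_tsub_cancel_left]
    rw [add_tsub_cancel_left, hkw] at hle ⊢
    obtain ⟨y, rfl⟩ := exists_add_of_le hle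
    rw [add_tsub_cancel_left]
    -- Since k <_T l, the correction term has a smaller leading exponent than r and leaves LP(h) =
    -- r.
    have hyr : y + ord.degree g ≺[ord] r := by
      have : ord.toSyn (y + ord.degree g + z) < ord.toSyn (r + z) := by
        rwa [show y + ord.degree g + z = k by rw [hw]; abel]
      rw [map_add _ _ z, map_add _ _ z] at this
      exact lt_of_add_lt_add_right this
    have hdlt : ord.degree (MvPolynomial.C (recEval ord U f (r + z) / recEval ord U g k) *
        (MvPolynomial.monomial y 1 * g)) ≺[ord]
        ord.degree (MvPolynomial.monomial (r - ord.degree f) 1 * f) := by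
      rw [hdeg]
      refine (degree_C_mul_le _ _).trans_lt ?_
      rwa [degree_monomial_mul _ haux.poly_ne_zero]
    refine ⟨by rw [ord.degree_sub_of_lt hdlt, hdeg], ne_zero_of_degree_sub hdlt,
      fun x hx => ?_⟩
    rw [map_sub, shiftEval_C_mul, shiftEval_monomial_mul, shiftEval_monomial_mul]
    rcases hx.lt_or_eq with hx | hx
    · have hxz : ord.toSyn x < ord.toSyn z := by
        rw [map_add, map_add] at hx
        exact lt_of_add_lt_add_left hx
      -- Before l both terms vanish separately, since the shift x < z places g at an index before k;
      -- at l the quotient of the two values makes them cancel.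
      rw [hlt x hx, haux.vanish (y + x) (before_coe.2 ?_), mul_zero, sub_zero]
      calc ord.toSyn (ord.degree g + (y + x)) < ord.toSyn (ord.degree g + (y + z)) := by
            simp only [map_add]
            gcongr
        _ = ord.toSyn k := by rw [hw, add_comm z y]
    · have hx := ord.toSyn.injective hx
      obtain rfl := add_left_cancel hx
      rw [heq x rfl, show y + x = k - ord.degree g by rw [hkw, add_comm],
        ← recEval_of_le haux.le, div_mul_cancel₀ _ haux.recEval_ne_zero, sub_self]

/-! ### The invariant of the algorithm and the Groebner basis -/

/-- The state `(F, G)` of the algorithm at the stage `n`. -/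
structure Invariant (ord : MonomialOrder (Fin 2)) (U : Idx → L) (B : Set Idx) (n : WithTop Idx)
    (F : Set (MvPolynomial (Fin 2) L)) (G : Set (MvPolynomial (Fin 2) L × Idx)) : Prop where
  ne_zero : ∀ f ∈ F, f ≠ 0
  degree_image : ord.degree '' F = {s | Minimal (· ∉ footprint ord F) s}
  injOn : Set.InjOn ord.degree F
  subset : footprint ord F ⊆ limitFootprint ord U
  vanish : ∀ f ∈ F, VanishesBefore ord U n f
  aux : ∀ p ∈ G, IsAux ord U p.1 p.2 ∧ p.2 ∈ B ∧ Before ord p.2 n ∧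
    Maximal (· ∈ footprint ord F) (p.2 - ord.degree p.1)
  exists_aux : ∀ c, Maximal (· ∈ footprint ord F) c → ∃! p, p ∈ G ∧ p.2 - ord.degree p.1 = c

theorem Invariant.init (B : Set Idx) : Invariant ord U B ((0 : Idx) : WithTop Idx) {1} ∅ := by
  have hfp : footprint ord ({1} : Set (MvPolynomial (Fin 2) L)) = ∅ := by
    ext x
    simp [footprint]
  refine ⟨by simp, ?_, by simp, by simp [hfp], ?_, by simp, ?_⟩
  · ext s
    simp only [hfp, Set.image_singleton, MonomialOrder.degree_one, Set.mem_singleton_iff,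
      Set.mem_empty_iff_false, not_false_eq_true, Set.mem_ofPred_eq]
    refine ⟨?_, fun h => h.eq_of_ge trivial (by simp)⟩
    rintro rfl
    exact ⟨trivial, fun _ _ _ => by simp⟩
  · intro f _ x hx
    rw [before_coe, map_zero] at hx
    exact absurd hx (by simp)
  · intro c hc
    rw [hfp] at hc
    exact absurd hc.1 (by simp)

theorem Invariant.step {B : Set Idx}
    (hBD : ∀ N ⊆ limitFootprint ord U, ∀ s j, Minimal (· ∉ N) s → j ∈ limitFootprint ord U →
      s + j ∈ B)
    {l : Idx} (hl : l ∈ B) {n : WithTop Idx} (hnext : IsNext ord B l n)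
    {F F' : Set (MvPolynomial (Fin 2) L)} {G G' : Set (MvPolynomial (Fin 2) L × Idx)}
    (inv : Invariant ord U B l F G) (hstep : Step ord U l F G F' G') :
    Invariant ord U B n F' G' ∧ footprint ord F' = newFootprint ord U l F := by
  obtain ⟨⟨φ, hφ, rfl⟩, rfl⟩ := hstep
  have hND : newFootprint ord U l F ⊆ limitFootprint ord U :=
    newFootprint_subset inv.subset fun f hf _ => inv.vanish f hf
  have hspec := fun r hr => (hφ r hr).spec (fun f hf _ => inv.ne_zero f hf)
    (fun f hf _ => inv.vanish f hf) fun p hp => ⟨(inv.aux p hp).1, before_coe.1 (inv.aux p hp).2.2.1⟩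
  have himg : ord.degree '' (φ '' {r | Minimal (· ∉ newFootprint ord U l F) r}) =
      {r | Minimal (· ∉ newFootprint ord U l F) r} := by
    rw [Set.image_image]
    exact (Set.image_congr (g := id) fun r hr => (hspec r hr).1).trans (Set.image_id _)
  have hfp := footprint_eq_of_degree_image (isLowerSet_newFootprint l F) himg
  refine ⟨⟨?_, by rw [hfp, himg], ?_, by rwa [hfp], ?_, ?_, ?_⟩, hfp⟩
  · rintro _ ⟨r, hr, rfl⟩
    exact (hspec r hr).2.1
  · rintro _ ⟨r, hr, rfl⟩ _ ⟨r', hr', rfl⟩ h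
    rw [(hspec r hr).1, (hspec r' hr').1] at h
    rw [h]
  · rintro _ ⟨r, hr, rfl⟩
    refine vanishesBefore_of_isNext hnext ?_ ?_
    · rw [(hspec r hr).1]
      exact fun j hj => hBD _ hND r j hr hj
    · rw [(hspec r hr).1]
      exact (hspec r hr).2.2
  · rw [hfp]
    rintro p (⟨hp, hmax⟩ | ⟨hpF, hpl, hp0, -, hmax⟩)
    · obtain ⟨haux, hB, hbef, -⟩ := inv.aux p hp
      exact ⟨haux, hB, hnext.before.trans_lt (before_coe.1 hbef), hmax⟩
    · rw [hpl]
      have hle := le_of_recEval_ne_zero hp0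
      exact ⟨⟨hle, by rwa [← recEval_of_le hle], inv.vanish _ hpF⟩, hl, hnext.before, hmax⟩
  · rw [hfp]
    intro c hc
    -- A maximal corner in the old footprint was already maximal there and keeps its old auxiliary
    -- polynomial; a new one comes from a failing f, unique because l - LP(f) determines LP(f), and
    -- `injOn` then determines f.
    by_cases hcF : c ∈ footprint ord F
    · obtain ⟨p, ⟨hp, hpc⟩, huniq⟩ := inv.exists_aux c (hc.mono (fun _ h => Or.inl h) hcF)
      refine ⟨p, ⟨Or.inl ⟨hp, hpc ▸ hc⟩, hpc⟩, ?_⟩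
      rintro p' ⟨⟨hp', -⟩ | ⟨-, hpl, -, hnot, -⟩, hpc'⟩
      · exact huniq p' ⟨hp', hpc'⟩
      · rw [hpl] at hpc'
        exact absurd (hpc' ▸ hcF) hnot
    · obtain ⟨f, hf, h0, hcf⟩ := hc.1.resolve_left hcF
      have hmem : l - ord.degree f ∈ newFootprint ord U l F := Or.inr ⟨f, hf, h0, le_rfl⟩
      obtain rfl := hc.eq_of_le hmem hcf
      refine ⟨(f, l), ⟨Or.inr ⟨hf, rfl, h0, hcF, hc⟩, rfl⟩, ?_⟩
      rintro ⟨g, k⟩ ⟨⟨hp', -⟩ | ⟨hg, hk, hg0, -, -⟩, hpc'⟩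
      · exact absurd (hpc' ▸ (inv.aux _ hp').2.2.2.1) hcF
      · dsimp only at hg hk hg0 hpc'
        subst hk
        have h1 := tsub_add_cancel_of_le (le_of_recEval_ne_zero hg0)
        have h2 := tsub_add_cancel_of_le (le_of_recEval_ne_zero h0)
        rw [hpc'] at h1
        rw [inv.injOn hg hf (add_left_cancel (h1.trans h2.symm))]

theorem Invariant.of_run {B : Set Idx} (hBfin : B.Finite) (h0 : (0 : Idx) ∈ B)
    (hBD : ∀ N ⊆ limitFootprint ord U, ∀ s j, Minimal (· ∉ N) s → j ∈ limitFootprint ord U →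
      s + j ∈ B)
    {F : WithTop Idx → Set (MvPolynomial (Fin 2) L)}
    {G : WithTop Idx → Set (MvPolynomial (Fin 2) L × Idx)} (hrun : IsRun ord B U F G) :
    (∀ l ∈ B, Invariant ord U B l (F l) (G l)) ∧ Invariant ord U B ⊤ (F ⊤) (G ⊤) := by
  have hinit : Invariant ord U B (0 : Idx) (F (0 : Idx)) (G (0 : Idx)) := by
    rw [hrun.init_F, hrun.init_G]
    exact Invariant.init B
  have hlater : ∀ n ∈ laterStages ord B 0, Invariant ord U B n (F n) (G n) := fun n hn =>
    laterStages_induction hBfin h0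
      (fun n hnext => (hinit.step hBD h0 hnext (hrun.step 0 h0 n hnext)).1)
      (fun k hk _ n hnext hinv => (hinv.step hBD hk hnext (hrun.step k hk n hnext)).1) hn
  refine ⟨fun l hl => ?_, hlater ⊤ (Or.inl rfl)⟩
  by_cases hl0 : l = 0
  · exact hl0 ▸ hinit
  · refine hlater l (Or.inr ⟨l, hl, lt_of_le_of_ne ?_ fun h => hl0 (ord.toSyn.injective h).symm,
      rfl⟩)
    exact ord.toSyn_monotone (zero_le (a := l))

/-- Every index precedes ⊤, so F ⊆ Λ(U). The inclusion of the footprint of F in D says that each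
leading exponent of Λ(U) lies above one of F. -/
theorem Invariant.isGroebnerBasis {B : Set Idx} {F : Set (MvPolynomial (Fin 2) L)}
    {G : Set (MvPolynomial (Fin 2) L × Idx)} (inv : Invariant ord U B ⊤ F G) :
    IsGroebnerBasis ord U F := by
  refine ⟨?_, fun f hf => mem_generatingAll.2 fun x => inv.vanish f hf x (before_top _), ?_⟩
  · refine Set.Finite.of_finite_image ?_ inv.injOn
    rw [inv.degree_image]
    exact finite_minimal_notMem _
  · intro p hp hp0
    have : ord.degree p ∉ footprint ord F := fun h => inv.subset h p ⟨hp, hp0⟩ le_rfl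
    simp only [footprint, Set.mem_ofPred_eq, not_forall, not_not] at this
    obtain ⟨f, hf, hfp⟩ := this
    exact ⟨f, hf, inv.ne_zero f hf, hfp⟩

/-! ### Steps with a rectangular footprint -/

theorem minimal_notMem_Iic {c s : Idx} :
    Minimal (· ∉ Set.Iic c) s ↔ s = pt (c 0 + 1) 0 ∨ s = pt 0 (c 1 + 1) := by
  have hA : pt (c 0 + 1) 0 ∉ Set.Iic c := by
    simp [Set.mem_Iic, Idx.le_iff]
  have hB : pt 0 (c 1 + 1) ∉ Set.Iic c := by
    simp [Set.mem_Iic, Idx.le_iff]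
  constructor
  · intro hs
    have h := hs.1
    simp only [Set.mem_Iic, Idx.le_iff, not_and_or, not_le] at h
    rcases h with h | h
    · exact Or.inl (hs.eq_of_le hA (by rw [Idx.le_iff, pt_zero, pt_one]; omega)).symm
    · exact Or.inr (hs.eq_of_le hB (by rw [Idx.le_iff, pt_zero, pt_one]; omega)).symm
  · rintro (rfl | rfl)
    · refine ⟨hA, fun y hy hle => ?_⟩
      simp only [Set.mem_Iic, Idx.le_iff, pt_zero, pt_one] at hy hle ⊢
      omega
    · refine ⟨hB, fun y hy hle => ?_⟩
      simp only [Set.mem_Iic, Idx.le_iff, pt_zero, pt_one] at hy hle ⊢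
      omega

theorem maximal_mem_Iic {c x : Idx} : Maximal (· ∈ Set.Iic c) x ↔ x = c := by
  constructor
  · intro h
    exact h.eq_of_le (Set.mem_Iic.2 le_rfl) h.1
  · rintro rfl
    exact ⟨Set.mem_Iic.2 le_rfl, fun y hy _ => hy⟩

theorem isReplacement_pair {m s : Idx} {q h x : MvPolynomial (Fin 2) L}
    {G : Set (MvPolynomial (Fin 2) L × Idx)} (hs : ¬ ord.degree h ≤ s) :
    IsReplacement ord U m {q, h} G s x ↔ IsReplacement ord U m {q} G s x := by
  constructor
  · rintro ⟨f, rfl | rfl, hfs, hx⟩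
    · exact ⟨f, rfl, hfs, hx⟩
    · exact absurd hfs hs
  · rintro ⟨f, rfl, hfs, hx⟩
    exact ⟨f, Or.inl rfl, hfs, hx⟩

theorem isReplacement_self {m : Idx} {h x : MvPolynomial (Fin 2) L}
    {G : Set (MvPolynomial (Fin 2) L × Idx)} (hm : ¬ ord.degree h ≤ m) :
    IsReplacement ord U m {h} G (ord.degree h) x ↔ x = h := by
  constructor
  · rintro ⟨f, rfl, -, ⟨-, rfl⟩ | ⟨-, hle, -⟩⟩
    · simp
    · exact absurd hle hm
  · rintro rfl
    exact ⟨x, rfl, le_rfl, Or.inl ⟨Or.inr hm, by simp⟩⟩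

/-- A step that does not change the footprint does not change `G` either. -/
theorem Step.aux_eq {m c k : Idx} {g : MvPolynomial (Fin 2) L}
    {F : Set (MvPolynomial (Fin 2) L)} (hfp : footprint ord F = Set.Iic c)
    (hN : newFootprint ord U m F = Set.Iic c) (hgk : k - ord.degree g = c) :
    ({p | p ∈ ({(g, k)} : Set (MvPolynomial (Fin 2) L × Idx)) ∧
        Maximal (· ∈ newFootprint ord U m F) (p.2 - ord.degree p.1)} ∪
      {p | p.1 ∈ F ∧ p.2 = m ∧ recEval ord U p.1 m ≠ 0 ∧ m - ord.degree p.1 ∉ footprint ord F ∧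
        Maximal (· ∈ newFootprint ord U m F) (m - ord.degree p.1)}) = {(g, k)} := by
  rw [hfp, hN]
  ext p
  constructor
  · rintro (h | ⟨-, -, -, hnot, hmax⟩)
    · exact h.1
    · exact absurd hmax.1 hnot
  · rintro rfl
    exact Or.inl ⟨rfl, maximal_mem_Iic.2 hgk⟩

theorem footprint_pair {c r r' : Idx} {q h : MvPolynomial (Fin 2) L}
    (hmin : ∀ s, Minimal (· ∉ Set.Iic c) s ↔ s = r' ∨ s = r)
    (hq : ord.degree q = r') (hh : ord.degree h = r) : footprint ord {q, h} = Set.Iic c := by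
  refine footprint_eq_of_degree_image (isLowerSet_Iic c) ?_
  rw [Set.image_pair, hq, hh]
  ext s
  exact (hmin s).symm

/-- The old footprint is already all of D, and the new one cannot leave D. -/
theorem newFootprint_pair {c r r' m : Idx} {q h : MvPolynomial (Fin 2) L}
    (hD : limitFootprint ord U = Set.Iic c)
    (hmin : ∀ s, Minimal (· ∉ Set.Iic c) s ↔ s = r' ∨ s = r)
    (hq : ord.degree q = r') (hh : ord.degree h = r) (hqv : VanishesBefore ord U m q)
    (hhv : recEval ord U h m ≠ 0 → VanishesBefore ord U m h) :
    newFootprint ord U m {q, h} = Set.Iic c := by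
  have hfp := footprint_pair hmin hq hh
  refine Set.Subset.antisymm ?_ fun x hx => Or.inl (hfp ▸ hx)
  rw [← hD]
  refine newFootprint_subset (hfp.trans hD.symm).subset ?_
  rintro f (rfl | rfl) h0
  exacts [hqv, hhv h0]

theorem not_le_of_minimal_pair {N : Set Idx} {r r' : Idx}
    (hmin : ∀ s, Minimal (· ∉ N) s ↔ s = r' ∨ s = r) (hne : r ≠ r') : ¬ r ≤ r' ∧ ¬ r' ≤ r := by
  have hr := (hmin r).2 (Or.inr rfl)
  have hr' := (hmin r').2 (Or.inl rfl)
  exact ⟨fun h => hne (hr'.eq_of_le hr.1 h), fun h => hne (hr.eq_of_le hr'.1 h).symm⟩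

theorem image_minimal_pair {N : Set Idx} {r r' : Idx} {φ : Idx → MvPolynomial (Fin 2) L}
    (hmin : ∀ s, Minimal (· ∉ N) s ↔ s = r' ∨ s = r) :
    φ '' {s | Minimal (· ∉ N) s} = {φ r', φ r} := by
  rw [← Set.image_pair]
  congr 1
  ext s
  exact hmin s

/-- The steps at indices that do not lie above the leading exponent `r` of `h`. -/
theorem step_pair_iff {c r r' m k : Idx} {q h g : MvPolynomial (Fin 2) L}
    {F' : Set (MvPolynomial (Fin 2) L)} {G' : Set (MvPolynomial (Fin 2) L × Idx)}
    (hD : limitFootprint ord U = Set.Iic c)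
    (hmin : ∀ s, Minimal (· ∉ Set.Iic c) s ↔ s = r' ∨ s = r) (hne : r ≠ r')
    (hq : ord.degree q = r') (hh : ord.degree h = r) (hqv : VanishesBefore ord U m q)
    (hrm : ¬ r ≤ m) (hgk : k - ord.degree g = c) :
    Step ord U m {q, h} {(g, k)} F' G' ↔
      ∃ q₂, IsReplacement ord U m {q} {(g, k)} r' q₂ ∧ F' = {q₂, h} ∧ G' = {(g, k)} := by
  obtain ⟨hle, hle'⟩ := not_le_of_minimal_pair hmin hne
  have hfp := footprint_pair hmin hq hh
  have hN := newFootprint_pair hD hmin hq hh hqv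
    fun h0 => absurd (recEval_of_not_le (hh.symm ▸ hrm)) h0
  have hr' : ∀ x, IsReplacement ord U m {q, h} {(g, k)} r' x ↔
      IsReplacement ord U m {q} {(g, k)} r' x := fun x => isReplacement_pair (by rwa [hh])
  have hr : ∀ x, IsReplacement ord U m {q, h} {(g, k)} r x ↔ x = h := fun x => by
    rw [Set.pair_comm, isReplacement_pair (by rwa [hq])]
    subst hh
    exact isReplacement_self hrm
  constructor
  · rintro ⟨⟨φ, hφ, rfl⟩, rfl⟩
    rw [Step.aux_eq hfp hN hgk]
    rw [hN] at hφ ⊢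
    refine ⟨φ r', (hr' _).1 (hφ r' ((hmin r').2 (Or.inl rfl))), ?_, rfl⟩
    rw [image_minimal_pair hmin, (hr _).1 (hφ r ((hmin r).2 (Or.inr rfl)))]
  · classical
    rintro ⟨q₂, hq₂, rfl, rfl⟩
    refine ⟨⟨fun s => if s = r' then q₂ else h, ?_, ?_⟩, (Step.aux_eq hfp hN hgk).symm⟩
    · rw [hN]
      intro s hs
      rcases (hmin s).1 hs with rfl | rfl
      · dsimp only
        rw [if_pos rfl]
        exact (hr' _).2 hq₂
      · dsimp only
        rw [if_neg hne]
        exact (hr _).2 rfl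
    · rw [hN, image_minimal_pair hmin, if_pos rfl, if_neg hne]

/-- The step at `l` in the exceptional cases. -/
theorem Step.exceptional {c r r' l k : Idx} {p p' g : MvPolynomial (Fin 2) L}
    {F' : Set (MvPolynomial (Fin 2) L)} {G' : Set (MvPolynomial (Fin 2) L × Idx)}
    (hD : limitFootprint ord U = Set.Iic c)
    (hmin : ∀ s, Minimal (· ∉ Set.Iic c) s ↔ s = r' ∨ s = r) (hne : r ≠ r')
    (hp' : ord.degree p' = r') (hp : ord.degree p = r) (hpv' : VanishesBefore ord U l p')
    (hpv : VanishesBefore ord U l p) (hl : l = r + c) (hrl : ¬ r' ≤ l)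
    (hgk : k - ord.degree g = c) (hstep : Step ord U l {p', p} {(g, k)} F' G') :
    F' = {p', corrected p g (recEval ord U g k) (recEval ord U p l)} ∧ G' = {(g, k)} := by
  obtain ⟨hle, hle'⟩ := not_le_of_minimal_pair hmin hne
  have hfp := footprint_pair hmin hp' hp
  have hN := newFootprint_pair hD hmin hp' hp hpv' fun _ => hpv
  obtain ⟨⟨φ, hφ, rfl⟩, rfl⟩ := hstep
  refine ⟨?_, Step.aux_eq hfp hN hgk⟩
  rw [hN] at hφ ⊢
  rw [image_minimal_pair hmin]
  have h1 := hφ r' ((hmin r').2 (Or.inl rfl))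
  rw [isReplacement_pair (by rwa [hp])] at h1
  replace h1 : φ r' = p' := by
    generalize φ r' = x at h1
    subst hp'
    exact (isReplacement_self hrl).1 h1
  have h2 := hφ r ((hmin r).2 (Or.inr rfl))
  rw [Set.pair_comm, isReplacement_pair (by rwa [hp'])] at h2
  obtain ⟨f, rfl, -, hx⟩ := h2
  -- As l - r = c = k - LP(g), the monomial factor of g in the Berlekamp procedure is 1.
  have hlr : l - r = c := by rw [hl, add_tsub_cancel_left]
  rw [h1]
  congr 2
  rcases hx with ⟨h0 | h0, hx⟩ | ⟨-, -, g', k', hg', -, hx⟩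
  -- If p does not fail at l, it is kept, which is the correction with b = 0.
  · rw [hx, hp, h0]
    simp [corrected]
  · exact absurd (hl ▸ le_self_add) h0
  · obtain ⟨rfl, rfl⟩ := Prod.mk.inj (Set.mem_singleton_iff.1 hg')
    rw [hx, hp, hgk, hlr, corrected]
    simp

/-- The stages of a run that is resumed with `{p', h}`, where no later index lies above the leading
exponent `r` of `h`. -/
theorem IsResumedRun.later {B : Set Idx} (hBfin : B.Finite)
    (hBD : ∀ N ⊆ limitFootprint ord U, ∀ s j, Minimal (· ∉ N) s → j ∈ limitFootprint ord U →
      s + j ∈ B)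
    {c r r' l k : Idx} (hlB : l ∈ B) {p' h g : MvPolynomial (Fin 2) L}
    {F : WithTop Idx → Set (MvPolynomial (Fin 2) L)}
    {G : WithTop Idx → Set (MvPolynomial (Fin 2) L × Idx)}
    (hD : limitFootprint ord U = Set.Iic c)
    (hmin : ∀ s, Minimal (· ∉ Set.Iic c) s ↔ s = r' ∨ s = r) (hne : r ≠ r')
    (hp' : ord.degree p' = r') (hh : ord.degree h = r) (hp0 : p' ≠ 0)
    (hpv : ∀ n, IsNext ord B l n → VanishesBefore ord U n p')
    (hrm : ∀ m ∈ B, l ≺[ord] m → ¬ r ≤ m) (hgk : k - ord.degree g = c) (haux : IsAux ord U g k)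
    (hkl : k ≺[ord] l) (hrun : IsResumedRun ord B U l {p', h} {(g, k)} F G)
    {n : WithTop Idx} (hn : n ∈ laterStages ord B l) :
    ∃ q, F n = {q, h} ∧ G n = {(g, k)} ∧ ord.degree q = r' ∧ q ≠ 0 ∧
      VanishesBefore ord U n q := by
  refine laterStages_induction (P := fun n => ∃ q, F n = {q, h} ∧ G n = {(g, k)} ∧
      ord.degree q = r' ∧ q ≠ 0 ∧ VanishesBefore ord U n q) hBfin hlB
    (fun n hnext => ⟨p', hrun.init_F n hnext, hrun.init_G n hnext, hp', hp0, hpv n hnext⟩) ?_ hn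
  rintro m hm hlm n hnext ⟨q, hF, hG, hq, hq0, hqv⟩
  have hstep := hrun.step m hm hlm n hnext
  rw [hF, hG, step_pair_iff hD hmin hne hq hh hqv (hrm m hm hlm) hgk] at hstep
  obtain ⟨q₂, hrep, hF', hG'⟩ := hstep
  obtain ⟨hdeg, hq₂0, hv⟩ := hrep.spec (by simpa using fun _ => hq0) (by simpa using fun _ => hqv)
    (by simpa using ⟨haux, hkl.trans hlm⟩)
  refine ⟨q₂, hF', hG', hdeg, hq₂0, vanishesBefore_of_isNext hnext ?_ ?_⟩
  · rw [hdeg]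
    exact fun j hj => hBD _ hD.symm.subset r' j ((hmin r').2 (Or.inl rfl)) hj
  · rwa [hdeg]

theorem degree_corrected {p g : MvPolynomial (Fin 2) L} (v a : L)
    (hlt : ord.degree g ≺[ord] ord.degree p) :
    ord.degree (corrected p g v a) = ord.degree p :=
  ord.degree_sub_of_lt ((degree_C_mul_le _ _).trans_lt hlt)

theorem shiftEval_corrected (x : Idx) (p g : MvPolynomial (Fin 2) L) (v a : L) :
    shiftEval U x (corrected p g v a) = shiftEval U x p - a / v * shiftEval U x g := by
  rw [corrected, map_sub, shiftEval_C_mul]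

/-- The rectangle below c already has as many points as D. -/
theorem eq_Iic_of_mem {D N : Set Idx} (hfin : D.Finite) (hN : IsLowerSet N)
    (hND : N ⊆ D) {c : Idx} (hc : c ∈ N) (hcard : D.ncard ≤ (c 0 + 1) * (c 1 + 1)) :
    D = Set.Iic c ∧ N = Set.Iic c := by
  have hsub : Set.Iic c ⊆ N := fun x hx => hN hx hc
  have heq : Set.Iic c = D := by
    refine Set.eq_of_subset_of_ncard_le (hsub.trans hND) ?_ hfin
    rwa [← Finset.coe_Iic, Set.ncard_coe_finset, Idx.card_Iic]
  exact ⟨heq.symm, (hND.trans heq.symm.subset).antisymm hsub⟩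

/-- If the footprint is a rectangle, then `F` has two members. -/
theorem eq_pair_of_footprint {c : Idx} {F : Set (MvPolynomial (Fin 2) L)}
    (himg : ord.degree '' F = {s | Minimal (· ∉ Set.Iic c) s}) {d : ℕ}
    {f : ℕ → MvPolynomial (Fin 2) L} (hf : F = f '' Set.Icc 1 d)
    (hs : StrictAntiOn (fun i => ord.degree (f i) 0) (Set.Icc 1 d)) :
    d = 2 ∧ F = {f 1, f 2} ∧ ord.degree (f 1) = pt (c 0 + 1) 0 ∧
      ord.degree (f 2) = pt 0 (c 1 + 1) := by
  have hmin : {s | Minimal (· ∉ Set.Iic c) s} = {pt (c 0 + 1) 0, pt 0 (c 1 + 1)} := by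
    ext s
    exact minimal_notMem_Iic
  rw [hmin, hf, Set.image_image] at himg
  have hinj : Set.InjOn (fun i => ord.degree (f i)) (Set.Icc 1 d) := fun i hi j hj h =>
    hs.injOn hi hj (congrArg (· 0) h)
  have hd : d = 2 := by
    have h := congrArg Set.ncard himg
    rw [hinj.ncard_image, Set.ncard_pair fun h => by simpa using congrArg (· 0) h,
      ← Finset.coe_Icc, Set.ncard_coe_finset] at h
    simpa using h
  subst hd
  have hIcc : Set.Icc 1 2 = ({1, 2} : Set ℕ) := by
    ext i
    simp only [Set.mem_Icc, Set.mem_insert_iff, Set.mem_singleton_iff]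
    omega
  have hlt : ord.degree (f 2) 0 < ord.degree (f 1) 0 :=
    hs (by simp) (by simp) one_lt_two
  have h1 : ord.degree (f 1) = pt (c 0 + 1) 0 ∨ ord.degree (f 1) = pt 0 (c 1 + 1) :=
    himg.subset ⟨1, by simp, rfl⟩
  have h2 : ord.degree (f 2) = pt (c 0 + 1) 0 ∨ ord.degree (f 2) = pt 0 (c 1 + 1) :=
    himg.subset ⟨2, by simp, rfl⟩
  refine ⟨rfl, by rw [hf, hIcc, Set.image_pair], ?_, ?_⟩
  · refine h1.resolve_right fun h => ?_
    rw [h, pt_zero] at hlt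
    omega
  · refine h2.resolve_left fun h => ?_
    rcases h1 with h1 | h1 <;> rw [h, h1] at hlt <;> simp at hlt

/-! ### The exceptional step and the stages after it -/

/-- A run at an index `l` where the footprint is a rectangle `{x | x ≤ c}` and already the final
one, and `l - c` is the leading exponent of a member `p` of `F_l`. -/
theorem exceptional_run {B : Set Idx} (hBfin : B.Finite) (h0 : (0 : Idx) ∈ B)
    (hBD : ∀ N ⊆ limitFootprint ord U, ∀ s j, Minimal (· ∉ N) s → j ∈ limitFootprint ord U →
      s + j ∈ B)
    {F : WithTop Idx → Set (MvPolynomial (Fin 2) L)}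
    {G : WithTop Idx → Set (MvPolynomial (Fin 2) L × Idx)} (hrun : IsRun ord B U F G)
    {c r r' l : Idx} (hlB : l ∈ B) {p p' : MvPolynomial (Fin 2) L}
    (hD : limitFootprint ord U = Set.Iic c) (hfp : footprint ord (F l) = Set.Iic c)
    (hmin : ∀ s, Minimal (· ∉ Set.Iic c) s ↔ s = r' ∨ s = r) (hne : r ≠ r')
    (hF : F l = {p', p}) (hp' : ord.degree p' = r') (hp : ord.degree p = r)
    (hl : l = r + c) (hrl : ¬ r' ≤ l) (hrm : ∀ m ∈ B, l ≺[ord] m → ¬ r ≤ m) :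
    ∃ (g : MvPolynomial (Fin 2) L) (k : Idx) (v : L),
      G l = {(g, k)} ∧ k ∈ B ∧ k ≺[ord] l ∧ v = recEval ord U g k ∧ v ≠ 0 ∧
      k = ord.degree g + c ∧
      (∃ b : L,
        corrected p g v b ∈ generating ord U l ∧
        (∀ m ∈ B, l ≼[ord] m → recEval ord U (corrected p g v b) m = 0) ∧
        (∀ n, IsNext ord B l n → F n = {p', corrected p g v b}) ∧
        (∀ n ∈ laterStages ord B l, corrected p g v b ∈ F n)) ∧
      IsGroebnerBasis ord U (F ⊤) ∧
      (∀ m ∈ B, l ≼[ord] m → G m = G l) ∧ G ⊤ = G l ∧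
      (∀ (a a' : L) (F' : WithTop Idx → Set (MvPolynomial (Fin 2) L))
        (G' : WithTop Idx → Set (MvPolynomial (Fin 2) L × Idx)),
        IsResumedRun ord B U l {p', corrected p g v a} (G l) F' G' →
          (∀ n ∈ laterStages ord B l, corrected p g v a ∈ F' n ∧ G' n = G l) ∧
          IsResumedRun ord B U l {p', corrected p g v a'} (G l)
            (fun n => F' n \ {corrected p g v a} ∪ {corrected p g v a'}) G') := by
  obtain ⟨hinv, hinvTop⟩ := Invariant.of_run hBfin h0 hBD hrun
  have inv := hinv l hlB
  obtain ⟨⟨g, k⟩, ⟨hgG, hgk⟩, huniq⟩ := inv.exists_aux c (by rw [hfp]; exact maximal_mem_Iic.2 rfl)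
  have hG : G l = {(g, k)} := by
    refine Set.eq_singleton_iff_unique_mem.2 ⟨hgG, fun q hq => huniq q ⟨hq, ?_⟩⟩
    have h := (inv.aux q hq).2.2.2
    rw [hfp] at h
    exact maximal_mem_Iic.1 h
  obtain ⟨haux, hkB, hkl, -⟩ := inv.aux _ hgG
  dsimp only at haux hkB hkl hgk
  rw [before_coe] at hkl
  have hk : k = ord.degree g + c := by rw [← hgk, add_tsub_cancel_of_le haux.le]
  have hpF : p ∈ F l := hF ▸ Or.inr rfl
  have hpF' : p' ∈ F l := hF ▸ Or.inl rfl
  -- Cancel c in k = LP(g) + c <_T r + c = l.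
  have hlt : ord.degree g ≺[ord] ord.degree p := by
    rw [hk, hl, map_add, map_add] at hkl
    rw [hp]
    exact lt_of_add_lt_add_right hkl
  have hdeg : ∀ a, ord.degree (corrected p g (recEval ord U g k) a) = r := fun a => by
    rw [degree_corrected _ _ hlt, hp]
  have hnextF : ∀ n, IsNext ord B l n →
      F n = {p', corrected p g (recEval ord U g k) (recEval ord U p l)} ∧ G n = {(g, k)} := by
    intro n hnext
    have hstep := hrun.step l hlB n hnext
    rw [hF, hG] at hstep
    exact hstep.exceptional hD hmin hne hp' hp (inv.vanish _ hpF') (inv.vanish _ hpF) hl hrl hgk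
  have hpv' : ∀ n, IsNext ord B l n → VanishesBefore ord U n p' := fun n hnext =>
    (inv.step hBD hlB hnext (hrun.step l hlB n hnext)).1.vanish p'
      ((hnextF n hnext).1 ▸ Or.inl rfl)
  have hlater := fun a F' G' (h : IsResumedRun ord B U l
      {p', corrected p g (recEval ord U g k) a} {(g, k)} F' G') n hn =>
    IsResumedRun.later hBfin hBD hlB hD hmin hne hp' (hdeg a) (inv.ne_zero _ hpF') hpv' hrm hgk haux
      hkl h (n := n) hn
  -- The given run is itself a resumed run, with b = p[U]_l, so the description of resumed runs
  -- covers it too.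
  have hrun' : IsResumedRun ord B U l
      {p', corrected p g (recEval ord U g k) (recEval ord U p l)} {(g, k)} F G :=
    ⟨fun n hn => (hnextF n hn).1, fun n hn => (hnextF n hn).2, fun k hk _ => hrun.step k hk⟩
  have hlaterG : ∀ n ∈ laterStages ord B l, G n = {(g, k)} := fun n hn => by
    obtain ⟨q, -, h, -⟩ := hlater _ _ _ hrun' n hn
    exact h
  refine ⟨g, k, recEval ord U g k, hG, hkB, hkl, rfl, haux.recEval_ne_zero, hk,
    ⟨recEval ord U p l, ?_, ?_, fun n hn => (hnextF n hn).1, ?_⟩, hinvTop.isGroebnerBasis, ?_,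
    ?_, ?_⟩
  · intro m hm hml
    rw [recEval_of_le hm]
    rw [hdeg] at hm ⊢
    obtain ⟨x, rfl⟩ := exists_add_of_le hm
    have hxc : ord.toSyn x < ord.toSyn c := by
      rw [hl, map_add, map_add] at hml
      exact lt_of_add_lt_add_left hml
    rw [add_tsub_cancel_left, shiftEval_corrected,
      inv.vanish p hpF x (before_coe.2 (by rwa [hp])), haux.vanish x (before_coe.2 ?_), mul_zero,
      sub_zero]
    rw [hk, map_add, map_add]
    gcongr
  · intro m hm hlm
    rcases hlm.eq_or_lt with h | h
    · obtain rfl := ord.toSyn.injective h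
      have hpl : ord.degree p ≤ l := by
        rw [hp, hl]
        exact le_self_add
      rw [recEval_of_le (by rwa [hdeg, ← hp]), hdeg, shiftEval_corrected,
        show l - r = k - ord.degree g by rw [hgk, hl, add_tsub_cancel_left],
        ← recEval_of_le haux.le, div_mul_cancel₀ _ haux.recEval_ne_zero, recEval_of_le hpl, hp,
        show l - r = k - ord.degree g by rw [hgk, hl, add_tsub_cancel_left], sub_self]
    · exact recEval_of_not_le (by rw [hdeg]; exact hrm m hm h)
  · intro n hn
    obtain ⟨q, h, -⟩ := hlater _ _ _ hrun' n hn
    exact h ▸ Or.inr rfl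
  · intro m hm hlm
    rcases hlm.eq_or_lt with h | h
    · rw [ord.toSyn.injective h]
    · rw [hG, hlaterG _ (Or.inr ⟨m, hm, h, rfl⟩)]
  · rw [hG, hlaterG _ (Or.inl rfl)]
  · intro a a' F' G' hres
    rw [hG] at hres ⊢
    have hst := hlater a F' G' hres
    -- The exchange of h_a for h_{a'} does not touch q, because LP(q) = r' differs from r.
    have hswap : ∀ q : MvPolynomial (Fin 2) L, ord.degree q = r' →
        ({q, corrected p g (recEval ord U g k) a} : Set (MvPolynomial (Fin 2) L)) \
          {corrected p g (recEval ord U g k) a} ∪ {corrected p g (recEval ord U g k) a'} =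
          {q, corrected p g (recEval ord U g k) a'} := by
      intro q hq
      have hqne : q ≠ corrected p g (recEval ord U g k) a := by
        rintro rfl
        exact hne ((hdeg a).symm.trans hq)
      rw [Set.insert_sdiff_of_notMem _ (by simpa using hqne), Set.sdiff_self]
      ext x
      simp [or_comm]
    refine ⟨fun n hn => ?_, fun n hn => ?_, hres.init_G, fun m hm hlm n hn => ?_⟩
    · obtain ⟨q, h1, h2, -⟩ := hst n hn
      exact ⟨h1 ▸ Or.inr rfl, h2⟩
    · rw [hres.init_F n hn, hswap _ hp']
    · obtain ⟨q, hFm, hGm, hq, -, hqv⟩ := hst m (Or.inr ⟨m, hm, hlm, rfl⟩)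
      have hstep := hres.step m hm hlm n hn
      rw [hFm, hGm, step_pair_iff hD hmin hne hq (hdeg a) hqv (hrm m hm hlm) hgk] at hstep
      obtain ⟨q₂, hrep, hFn, hGn⟩ := hstep
      -- F' at n is known both as {q₂, h_a} and as {q₃, h_a} with LP(q₃) = r'; comparing the two
      -- sets gives LP(q₂) = r'.
      have hq₂ : ord.degree q₂ = r' := by
        have hmn : n ∈ laterStages ord B l := by
          rcases hn.1 with h | ⟨k', hk', hmk, h⟩
          · exact Or.inl h
          · exact Or.inr ⟨k', hk', hlm.trans hmk, h⟩
        obtain ⟨q₃, hFn', -, hq₃, -⟩ := hst n hmn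
        have hmem : q₂ ∈ F' n := hFn ▸ Or.inl rfl
        rw [hFn'] at hmem
        rcases hmem with rfl | rfl
        · exact hq₃
        · have hmem₃ : q₃ ∈ F' n := hFn' ▸ Or.inl rfl
          rw [hFn] at hmem₃
          rcases hmem₃ with rfl | rfl <;> exact hq₃
      rw [hFm, hGm, hFn, hswap _ hq, hswap _ hq₂,
        step_pair_iff hD hmin hne hq (hdeg a') hqv (hrm m hm hlm) hgk]
      exact ⟨q₂, hrep, rfl, hGn⟩

end BMS

end

/-! ### The two exceptional cases -/

theorem mainTheorem4
    {K L : Type*} [Field K] [Fintype K] [Field L] [Algebra K L]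
    (r : Fin 2 → ℕ) (hq : Nat.Coprime (Fintype.card K) (r 0 * r 1))
    (α : Fin 2 → L) (hα : ∀ i, α i ^ r i = 1)
    (t : ℕ) (ht2 : 2 ≤ t) (ht4 : t ≤ 4) (htr : ∀ i, t ≤ r i / 2)
    (e : MvPolynomial (Fin 2) K) (he : ∀ m ∈ e.support, m ∈ BMS.indexBox r)
    (hwt : e.support.card ≤ t)
    (τ : BMS.Idx) (hτ : τ ∈ BMS.indexBox r)
    (U : BMS.Idx → L) (hU : U = BMS.syndromeTable α τ e)
    (ord : MonomialOrder (Fin 2))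
    (hord : ord = MonomialOrder.lex ∨ ord = BMS.gradedOrder)
    (B : Set BMS.Idx) (hB : B = BMS.hyperbolicSet r (2 * t + 1))
    -- a run of the algorithm
    (F : WithTop BMS.Idx → Set (MvPolynomial (Fin 2) L))
    (G : WithTop BMS.Idx → Set (MvPolynomial (Fin 2) L × BMS.Idx))
    (hrun : BMS.IsRun ord B U F G)
    -- the polynomials of `F_l`, numbered by decreasing first coordinate of the leading exponents
    (l : BMS.Idx) (d : ℕ) (f : ℕ → MvPolynomial (Fin 2) L)
    (hf : F l = f '' Set.Icc 1 d)
    (hs : StrictAntiOn (fun i => ord.degree (f i) 0) (Set.Icc 1 d))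
    -- the two exceptional cases; `p` is the polynomial to be corrected, `p'` the other one
    (p p' : MvPolynomial (Fin 2) L)
    (hcase :
      (l = BMS.pt 0 (2 * t - 1) ∧ 2 ≤ d ∧ ord.degree (f 2) 1 = t ∧ p = f 2 ∧ p' = f 1) ∨
      (l = BMS.pt (2 * t - 1) 0 ∧ 1 ≤ d ∧ ord.degree (f 1) 0 = t ∧ p = f 1 ∧ p' = f 2)) :
    d = 2 ∧
    ∃ (g : MvPolynomial (Fin 2) L) (k : BMS.Idx) (v : L),
      -- `G_l = {g}`, with associated index `k`
      G l = {(g, k)} ∧ k ∈ BMS.indexBox r ∧ k ≺[ord] l ∧ v = BMS.recEval ord U g k ∧ v ≠ 0 ∧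
      k = ord.degree g + BMS.pt (ord.degree (f 1) 0 - 1) (ord.degree (f 2) 1 - 1) ∧
      -- a)
      (∃ b : L,
        BMS.corrected p g v b ∈ BMS.generating ord U l ∧
        (∀ m ∈ B, l ≼[ord] m → BMS.recEval ord U (BMS.corrected p g v b) m = 0) ∧
        (∀ n, BMS.IsNext ord B l n → F n = {p', BMS.corrected p g v b}) ∧
        (∀ n ∈ BMS.laterStages ord B l, BMS.corrected p g v b ∈ F n)) ∧
      BMS.IsGroebnerBasis ord U (F ⊤) ∧
      -- b)
      (∀ m ∈ B, l ≼[ord] m → G m = G l) ∧ G ⊤ = G l ∧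
      -- the updates after the step at `l` do not depend on the choice of `b`
      (∀ (c c' : L) (F' : WithTop BMS.Idx → Set (MvPolynomial (Fin 2) L))
        (G' : WithTop BMS.Idx → Set (MvPolynomial (Fin 2) L × BMS.Idx)),
        BMS.IsResumedRun ord B U l {p', BMS.corrected p g v c} (G l) F' G' →
          (∀ n ∈ BMS.laterStages ord B l, BMS.corrected p g v c ∈ F' n ∧ G' n = G l) ∧
          BMS.IsResumedRun ord B U l {p', BMS.corrected p g v c'} (G l)
            (fun n => F' n \ {BMS.corrected p g v c} ∪ {BMS.corrected p g v c'}) G') := by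
  subst hU hB
  obtain ⟨hfin, hcard⟩ := BMS.limitFootprint_syndromeTable (ord := ord) α τ e
  replace hcard := hcard.trans hwt
  have hlow := BMS.isLowerSet_limitFootprint (ord := ord) (U := BMS.syndromeTable α τ e)
  have hBfin := BMS.finite_hyperbolicSet r (2 * t + 1)
  have hr0 := htr 0
  have hr1 := htr 1
  have hmem : ∀ a b : ℕ, a < 2 * t → b < 2 * t → (a + 1) * (b + 1) ≤ 2 * t + 1 →
      BMS.pt a b ∈ BMS.hyperbolicSet r (2 * t + 1) := by
    intro a b ha hb hab
    refine ⟨⟨Fin.forall_fin_two.2 ⟨by rw [BMS.pt_zero]; omega, by rw [BMS.pt_one]; omega⟩,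
      by simpa using hab⟩, ?_⟩
    rintro (h | h) <;> simp [BMS.Idx.ext_iff] at h <;> omega
  have h0 : (0 : BMS.Idx) ∈ BMS.hyperbolicSet r (2 * t + 1) := by
    simpa [BMS.pt] using hmem 0 0 (by omega) (by omega) (by omega)
  have hBD : ∀ N ⊆ BMS.limitFootprint ord (BMS.syndromeTable α τ e), ∀ s j,
      Minimal (· ∉ N) s → j ∈ BMS.limitFootprint ord (BMS.syndromeTable α τ e) →
        s + j ∈ BMS.hyperbolicSet r (2 * t + 1) :=
    fun N hN s j hs hj => BMS.add_mem_hyperbolicSet ht4 htr hlow hfin hcard hN hs hj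
  have hinv := (BMS.Invariant.of_run hBfin h0 hBD hrun).1
  have hminF : ∀ l ∈ BMS.hyperbolicSet r (2 * t + 1), ∀ q ∈ F l,
      Minimal (· ∉ BMS.footprint ord (F l)) (ord.degree q) := fun l hl q hq =>
    (hinv l hl).degree_image.subset (Set.mem_image_of_mem _ hq)
  rcases hcase with ⟨rfl, hd, hst, rfl, rfl⟩ | ⟨rfl, hd, hst, rfl, rfl⟩
  · have hlB := hmem 0 (2 * t - 1) (by omega) (by omega) (by omega)
    have inv := hinv _ hlB
    have hm := hminF _ hlB (f 2) (hf ▸ Set.mem_image_of_mem f ⟨by omega, hd⟩)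
    -- One step below the minimal point LP(f 2), whose second coordinate is t.
    have hpred : BMS.pt (ord.degree (f 2) 0) (t - 1) ∈
        BMS.footprint ord (F ↑(BMS.pt 0 (2 * t - 1))) :=
      BMS.pred_mem_of_minimal hm (by rw [BMS.Idx.le_iff]; simp; omega)
        (by rw [Ne, BMS.Idx.ext_iff]; simp; omega)
    have hdeg0 : ord.degree (f 2) 0 = 0 := by
      have h := (BMS.card_Iic_le_ncard hlow hfin (inv.subset hpred)).trans hcard
      rw [BMS.pt_zero, BMS.pt_one, Nat.sub_add_cancel (by omega)] at h
      by_contra hne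
      -- A second column of height t would give D at least 2t > t points. So LP(f 2) = (0, t), and
      -- the t points of a single column fill D.
      have : 2 * t ≤ (ord.degree (f 2) 0 + 1) * t := Nat.mul_le_mul_right _ (by omega)
      omega
    rw [hdeg0] at hpred
    obtain ⟨hD, hfp⟩ := BMS.eq_Iic_of_mem hfin (BMS.isLowerSet_footprint _) inv.subset hpred
      (hcard.trans (by simp; omega))
    have himg := inv.degree_image
    rw [hfp] at himg
    obtain ⟨hd2, hFl, h1, h2⟩ := BMS.eq_pair_of_footprint himg hf hs
    refine ⟨hd2, ?_⟩
    obtain ⟨g, k, v, hG, hkB, hrest⟩ := BMS.exceptional_run hBfin h0 hBD hrun hlB hD hfp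
      (fun s => BMS.minimal_notMem_Iic) (by simp [BMS.Idx.ext_iff]) hFl h1 h2
      (by rw [BMS.Idx.ext_iff]; simp; omega) (by simp [BMS.Idx.le_iff]) (by
        intro m hmB hlm hle
        have hp := hmB.1.2
        simp only [BMS.Idx.le_iff, BMS.pt_zero, BMS.pt_one] at hle
        -- An index of B above (0, t) has first coordinate 0, as 2(t + 1) > 2t + 1. Its second
        -- coordinate is at most 2t, and (0, 2t) was removed from B, so it does not come after l.
        have hm0 : m 0 = 0 := by
          by_contra hne
          have : 2 * (t + 1) ≤ (m 0 + 1) * (m 1 + 1) := Nat.mul_le_mul (by omega) (by omega)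
          omega
        have hm1 : m 1 ≠ 2 * t := fun h => hmB.2 (Or.inr (by
          rw [Set.mem_singleton_iff, BMS.Idx.ext_iff]; simp [hm0, h]))
        rw [hm0] at hp
        refine absurd (ord.toSyn_monotone (?_ : m ≤ BMS.pt 0 (2 * t - 1))) (not_le.2 hlm)
        rw [BMS.Idx.le_iff, BMS.pt_zero, BMS.pt_one]
        omega)
    refine ⟨g, k, v, hG, hkB.1.1, ?_⟩
    rw [h1, h2]
    simpa using hrest
  · have hlB := hmem (2 * t - 1) 0 (by omega) (by omega) (by omega)
    have inv := hinv _ hlB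
    have hm := hminF _ hlB (f 1) (hf ▸ Set.mem_image_of_mem f ⟨by omega, hd⟩)
    have hpred : BMS.pt (t - 1) (ord.degree (f 1) 1) ∈
        BMS.footprint ord (F ↑(BMS.pt (2 * t - 1) 0)) :=
      BMS.pred_mem_of_minimal hm (by rw [BMS.Idx.le_iff]; simp; omega)
        (by rw [Ne, BMS.Idx.ext_iff]; simp; omega)
    have hdeg0 : ord.degree (f 1) 1 = 0 := by
      have h := (BMS.card_Iic_le_ncard hlow hfin (inv.subset hpred)).trans hcard
      rw [BMS.pt_zero, BMS.pt_one, Nat.sub_add_cancel (by omega)] at h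
      by_contra hne
      have : t * 2 ≤ t * (ord.degree (f 1) 1 + 1) := Nat.mul_le_mul_left _ (by omega)
      omega
    rw [hdeg0] at hpred
    obtain ⟨hD, hfp⟩ := BMS.eq_Iic_of_mem hfin (BMS.isLowerSet_footprint _) inv.subset hpred
      (hcard.trans (by simp; omega))
    have himg := inv.degree_image
    rw [hfp] at himg
    obtain ⟨hd2, hFl, h1, h2⟩ := BMS.eq_pair_of_footprint himg hf hs
    refine ⟨hd2, ?_⟩
    obtain ⟨g, k, v, hG, hkB, hrest⟩ := BMS.exceptional_run hBfin h0 hBD hrun hlB hD hfp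
      -- Now the corrected polynomial is the one with leading exponent (t, 0), so the two minimal
      -- points exchange roles.
      (fun s => BMS.minimal_notMem_Iic.trans or_comm) (by simp [BMS.Idx.ext_iff])
      (hFl.trans (Set.pair_comm _ _)) h2 h1
      (by rw [BMS.Idx.ext_iff]; simp; omega) (by simp [BMS.Idx.le_iff]) (by
        intro m hmB hlm hle
        have hp := hmB.1.2
        simp only [BMS.Idx.le_iff, BMS.pt_zero, BMS.pt_one] at hle
        have hm1 : m 1 = 0 := by
          by_contra hne
          have : (t + 1) * 2 ≤ (m 0 + 1) * (m 1 + 1) := Nat.mul_le_mul (by omega) (by omega)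
          omega
        have hm0 : m 0 ≠ 2 * t := fun h => hmB.2 (Or.inl (by
          rw [BMS.Idx.ext_iff]; simp [hm1, h]))
        rw [hm1] at hp
        refine absurd (ord.toSyn_monotone (?_ : m ≤ BMS.pt (2 * t - 1) 0)) (not_le.2 hlm)
        rw [BMS.Idx.le_iff, BMS.pt_zero, BMS.pt_one]
        omega)
    refine ⟨g, k, v, hG, hkB.1.1, ?_⟩
    rw [h1, h2]
    simpa using hrest
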